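/- **Setting.** Let $\mathbb{F}_q$ be a finite field of characteristic $p>3$, let $\mathcal{O}=\mathbb{F}_q[t]$ with set $\mathcal{O}^+$ of monic elements, and let $K_\infty=\mathbb{F}_q((1/t))$ with the absolute value $|\sum_{i\le N}a_it^i|=q^N$ if $a_N\ne0$, and $|0|=0$ (so $|r|=q^{\deg r}$ for $0\neq r\in\mathcal{O}$). Give $K_\infty$ the Haar measure for which $\{\theta:|\theta|<1\}$ has measure $1$, and $K_\infty^6$ the product measure. Put $\psi(\sum_i a_it^i)=\exp(2\pi i\,\mathrm{Tr}_{\mathbb{F}_q/\mathbb{F}_p}(a_{-1})/p)$ and $F(\boldsymbol{x})=x_1^3+\dots+x_6^3$. For a real number $A\ge 0$ and $\alpha\in\{0,1,2\}$ let $\nu_{A,\alpha}$ be the indicator function of the set of $(x,y,z)\in K_\infty^3$ with $|x^3+y^3+z^3|=q^\alpha$, $1\le|x|=|y|\le q^{\alpha/3+A}$ and $|y|q^{-1}\le|z|\le|y|$. Let $w(\boldsymbol{x})=w_{A,\alpha}(\boldsymbol{x})=\nu_{A,\alpha}(x_1,x_2,x_3)\,\nu_{A,\alpha}(x_4,x_5,x_6)$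 and $\tilde A=\lfloor\alpha/3+A\rfloor$. For $d\in\mathbb{Z}$ let $P=t^d$, $Q=\lfloor-2\tilde A+3d/2\rfloor$ and $\widehat{Q}=q^Q$. For $r\in\mathcal{O}^+$ let $$S_r(\boldsymbol{0})=\sum_{\substack{a\in\mathcal{O},\ |a|<|r|\\ \gcd(a,r)=1}}\ \sum_{\substack{\boldsymbol{x}\in\mathcal{O}^6\\ |\boldsymbol{x}|<|r|}}\psi\!\left(\frac{aF(\boldsymbol{x})}{r}\right),\qquad I_r(\boldsymbol{0})=\int_{|\theta|<|r|^{-1}\widehat{Q}^{-1}}\int_{K_\infty^6}w(\boldsymbol{x})\,\psi(\theta P^3F(\boldsymbol{x}))\,d\boldsymbol{x}\,d\theta,$$ where $|\boldsymbol{x}|=\max_i|x_i|$. The $\boldsymbol{c}=\boldsymbol{0}$ term of the circle method, the singular series and the singular integral are $$M(P)=|P|^6\sum_{\substack{r\in\mathcal{O}^+\\ |r|\le\widehat{Q}}}|r|^{-6}S_r(\boldsymbol{0})I_r(\boldsymbol{0}),\qquad \mathfrak{S}=\sum_{r\in\mathcal{O}^+}|r|^{-6}S_r(\boldsymbol{0}),\qquad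 \sigma_\infty=\int_{|\theta|\le q^{4\tilde A}}\int_{K_\infty^6}w(\boldsymbol{x})\,\psi(\theta F(\boldsymbol{x}))\,d\boldsymbol{x}\,d\theta .$$ **Proposition 6.1.** The series $\mathfrak{S}$ converges absolutely. For every $\varepsilon>0$ there is a constant $C$, depending only on $\mathbb{F}_q$ and $\varepsilon$, such that for all real $A\ge0$, all $\alpha\in\{0,1,2\}$ and all $d\in\mathbb{Z}$ for which $Q\ge 0$ or $\varepsilon\le 2/3$, $$\bigl|M(P)-\sigma_\infty\mathfrak{S}|P|^3\bigr|\le C\,|\sigma_\infty|\,|P|^3\,\widehat{Q}^{-2/3+\varepsilon}.$$ -/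

import Mathlib

open MeasureTheory Polynomial

noncomputable section

namespace CubicCircle

/-! ### The field `K_∞ = 𝔽_q((1/t))`

Throughout, `F` is the finite field `𝔽_q`, the ring `𝓞 = 𝔽_q[t]` is `F[X]`, and `K_∞` is the field
of formal Laurent series over `F` in the variable `s = t⁻¹`.  The coefficient of `tⁿ` in
`γ ∈ K_∞` is therefore `γ.coeff (-n)`. -/

/-- The completion `K_∞ = 𝔽_q((1/t))`; the power series variable is `s = 1/t`. -/
abbrev KInf (F : Type*) [Field F] : Type _ := LaurentSeries F

section Field

variable {F : Type*} [Field F]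

/-- The element `t` of `K_∞`. -/
def tInf : KInf F := HahnSeries.single (-1 : ℤ) (1 : F)

/-- The embedding `𝔽_q[t] → K_∞`, sending `t` to `t`. -/
def toKInf : F[X] →+* KInf F := (aeval (R := F) (tInf : KInf F)).toRingHom

variable [Fintype F]

/-- The absolute value on `K_∞`: `|γ| = q^N` if `γ = ∑_{i ≤ N} a_i t^i` with `a_N ≠ 0`. -/
def absInf (γ : KInf F) : ℝ :=
  open Classical in if γ = 0 then 0 else (Fintype.card F : ℝ) ^ (-γ.order)

/-- `𝕋 = {γ ∈ K_∞ : |γ| < 1}`. -/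
def unitBall (F : Type*) [Field F] [Fintype F] : Set (KInf F) := {γ | absInf γ < 1}

instance : MeasurableSpace (KInf F) := borel _

instance : BorelSpace (KInf F) := ⟨rfl⟩

theorem mem_unitBall_iff (γ : KInf F) : γ ∈ unitBall F ↔ ∀ n : ℤ, n < 1 → γ.coeff n = 0 := by
  have hq : (1 : ℝ) < Fintype.card F := by exact_mod_cast Fintype.one_lt_card
  unfold unitBall absInf
  by_cases h : γ = 0
  · simp [h]
  · simp only [h, if_false, Set.mem_ofPred_eq]
    rw [zpow_lt_one_iff_right₀ hq]
    constructor
    · intro h1 n hn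
      exact HahnSeries.coeff_eq_zero_of_lt_order (by omega)
    · intro h1
      by_contra h2
      exact HahnSeries.coeff_order_eq_zero.not.mpr h (h1 _ (by omega))

theorem unitBall_eq_valued (F : Type*) [Field F] [Fintype F] :
    unitBall F = {γ | Valued.v γ ≤ WithZero.exp (-1 : ℤ)} := by
  ext γ
  rw [mem_unitBall_iff, Set.mem_ofPred_eq, LaurentSeries.valuation_le_iff_coeff_lt_eq_zero]

theorem isOpen_unitBall (F : Type*) [Field F] [Fintype F] : IsOpen (unitBall F) := by
  rw [unitBall_eq_valued]
  have hx : Valued.v (HahnSeries.single (1 : ℤ) (1 : F) : KInf F) = WithZero.exp (-1 : ℤ) := by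
    simpa using LaurentSeries.valuation_single_zpow F 1
  have h0 : Valued.v.restrict (HahnSeries.single (1 : ℤ) (1 : F) : KInf F) ≠ 0 := by
    rw [Ne, Valuation.restrict_eq_zero_iff, hx]
    exact WithZero.exp_ne_zero
  convert Valued.isOpen_closedBall (KInf F) h0 using 3
  rw [Valuation.restrict_le_iff, hx]

theorem isCompact_unitBall (F : Type*) [Field F] [Fintype F] : IsCompact (unitBall F) := by
  let _ : TopologicalSpace F := ⊥
  have _ : DiscreteTopology F := ⟨rfl⟩
  let g : (ℕ → F) → KInf F :=
    fun a => HahnSeries.single (1 : ℤ) (1 : F) * HahnSeries.ofPowerSeries ℤ F (PowerSeries.mk a)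
  have hcoeff : ∀ (a : ℕ → F) (n : ℤ), (g a).coeff n = if 1 ≤ n then a (n - 1).toNat else 0 := by
    intro a n
    have h1 : (g a).coeff n = (HahnSeries.ofPowerSeries ℤ F (PowerSeries.mk a)).coeff (n - 1) := by
      have := HahnSeries.coeff_single_mul_add (r := (1 : F))
        (x := HahnSeries.ofPowerSeries ℤ F (PowerSeries.mk a)) (a := n - 1) (b := (1 : ℤ))
      simpa [g] using this
    rw [h1]
    split_ifs with hn
    · obtain ⟨m, hm⟩ : ∃ m : ℕ, n - 1 = m := ⟨(n - 1).toNat, by omega⟩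
      rw [hm, LaurentSeries.coeff_coe_powerSeries]
      simp
    · have := PowerSeries.coeff_coe (R := F) (f := PowerSeries.mk a) (n - 1)
      rw [if_pos (by omega)] at this
      exact this
  have hg : Continuous g := by
    rw [continuous_iff_continuousAt]
    intro a
    intro s hs
    obtain ⟨γ, hγ⟩ := Valued.mem_nhds.mp hs
    set e := MonoidWithZeroHom.ValueGroup₀.embedding γ.1 with he
    have he0 : e ≠ 0 := by
      rw [he]
      simp
    have hopen : {b : ℕ → F | ∀ i ∈ Finset.range (-(WithZero.log e) + 1).toNat, b i = a i}
        ∈ nhds a := by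
      have h2 : {b : ℕ → F | ∀ i ∈ Finset.range (-(WithZero.log e) + 1).toNat, b i = a i}
          = (↑(Finset.range (-(WithZero.log e) + 1).toNat) : Set ℕ).pi fun i => {a i} := by
        ext b
        simp [Set.mem_pi]
      rw [h2]
      exact set_pi_mem_nhds (Finset.finite_toSet _) fun i _ => by simp
    rw [Filter.mem_map]
    filter_upwards [hopen] with b hb
    apply hγ
    rw [Set.mem_ofPred_eq, Valuation.restrict_lt_iff_lt_embedding, ← he]
    refine lt_of_le_of_lt ((LaurentSeries.valuation_le_iff_coeff_lt_eq_zero F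
      (D := -(WithZero.log e) + 1)).mpr ?_) ((WithZero.lt_log_iff_exp_lt he0).mp (by omega))
    intro n hn
    rw [HahnSeries.coeff_sub, hcoeff, hcoeff]
    split_ifs with h1
    · rw [hb _ (by simp; omega), sub_self]
    · simp
  have hr : unitBall F = Set.range g := by
    ext γ
    rw [mem_unitBall_iff]
    constructor
    · intro h
      refine ⟨fun n => γ.coeff (n + 1), ?_⟩
      ext n
      rw [hcoeff]
      split_ifs with hn
      · congr 1; omega
      · exact (h n (by omega)).symm
    · rintro ⟨a, rfl⟩ n hn
      rw [hcoeff, if_neg (by omega)]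
  rw [hr]
  exact isCompact_range hg

/-- `𝕋` as a compact set with non-empty interior. -/
def unitBallCompacts (F : Type*) [Field F] [Fintype F] :
    TopologicalSpace.PositiveCompacts (KInf F) where
  carrier := unitBall F
  isCompact' := isCompact_unitBall F
  interior_nonempty' := by
    rw [(isOpen_unitBall F).interior_eq]
    exact ⟨0, by simp [unitBall, absInf]⟩

/-- The Haar measure `dθ` on `K_∞`, normalised so that `𝕋` has measure `1`. -/
def haarInf (F : Type*) [Field F] [Fintype F] : Measure (KInf F) :=
  Measure.addHaarMeasure (unitBallCompacts F)

/-- The product measure `dx = dx₁ ⋯ dx₆` on `K_∞⁶`. -/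
def haarInf6 (F : Type*) [Field F] [Fintype F] : Measure (Fin 6 → KInf F) :=
  Measure.pi fun _ => haarInf F

/-- The additive character `ψ(γ) = exp(2πi Tr(a_{-1}) / p)` for `γ = ∑_i a_i t^i ∈ K_∞`, where `p`
is the characteristic of `𝔽_q` and `Tr` is the trace from `𝔽_q` to `𝔽_p`. -/
def psi (γ : KInf F) : ℂ :=
  letI : NeZero (ringChar F) := ⟨CharP.ringChar_ne_zero_of_finite F⟩
  letI : Algebra (ZMod (ringChar F)) F := ZMod.algebra F (ringChar F)
  ZMod.stdAddChar (Algebra.trace (ZMod (ringChar F)) F (γ.coeff 1))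

/-! ### The cubic form and the weights -/

/-- `F(x) = x₁³ + ⋯ + x₆³`. -/
def cubicForm {R : Type*} [CommRing R] (x : Fin 6 → R) : R := ∑ i, x i ^ 3

/-- `ν_{A,α}(x,y,z)` is the indicator function of the conditions `|x³ + y³ + z³| = q^α`,
`1 ≤ |x| = |y| ≤ q^{α/3+A}` and `|y|/q ≤ |z| ≤ |y|`. -/
def nu (A : ℝ) (α : ℕ) (x y z : KInf F) : ℝ :=
  open Classical in
  if absInf (x ^ 3 + y ^ 3 + z ^ 3) = (Fintype.card F : ℝ) ^ α ∧
      (1 ≤ absInf x ∧ absInf x = absInf y ∧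
        absInf y ≤ (Fintype.card F : ℝ) ^ ((α : ℝ) / 3 + A)) ∧
      (absInf y * (Fintype.card F : ℝ)⁻¹ ≤ absInf z ∧ absInf z ≤ absInf y)
  then 1 else 0

/-- `w_{A,α}(x₁,…,x₆) = ν_{A,α}(x₁,x₂,x₃) ν_{A,α}(x₄,x₅,x₆)`. -/
def weight (A : ℝ) (α : ℕ) (x : Fin 6 → KInf F) : ℝ :=
  nu A α (x 0) (x 1) (x 2) * nu A α (x 3) (x 4) (x 5)

/-! ### Exponential sums and the singular series -/

/-- The absolute value `|r| = q^{deg r}` on `𝔽_q[t]` (with `|0| = 0`). -/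
def polyAbs (r : F[X]) : ℝ :=
  open Classical in if r = 0 then 0 else (Fintype.card F : ℝ) ^ r.natDegree

theorem finite_degree_lt (F : Type*) [Field F] [Fintype F] (n : WithBot ℕ) :
    {a : F[X] | a.degree < n}.Finite := by
  induction n with
  | bot => simp
  | coe n =>
    have h : Finite (degreeLT F n) := Finite.of_equiv _ (degreeLTEquiv F n).toEquiv.symm
    refine Set.Finite.subset (Set.toFinite ((degreeLT F n : Submodule F F[X]) : Set F[X])) ?_
    intro a ha
    exact mem_degreeLT.mpr ha

theorem finite_monic_le (F : Type*) [Field F] [Fintype F] (Q : ℤ) :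
    {r : F[X] | r.Monic ∧ (r.natDegree : ℤ) ≤ Q}.Finite := by
  refine (finite_degree_lt F ((Q.toNat + 1 : ℕ) : WithBot ℕ)).subset ?_
  rintro r ⟨-, hr⟩
  exact lt_of_le_of_lt degree_le_natDegree (by exact_mod_cast (by omega))

/-- The polynomials `a` with `|a| < |r|`. -/
def residues (r : F[X]) : Finset F[X] := (finite_degree_lt F r.degree).toFinset

/-- The monic polynomials `r` with `|r| ≤ q^Q`. -/
def monicUpTo (F : Type*) [Field F] [Fintype F] (Q : ℤ) : Finset F[X] :=
  (finite_monic_le F Q).toFinset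

/-- `S_r(c) = ∑_{|a| < |r|, gcd(a,r) = 1} ∑_{|x| < |r|} ψ((a F(x) - c·x) / r)`. -/
def expSum (r : F[X]) (c : Fin 6 → F[X]) : ℂ :=
  open Classical in
  ∑ a ∈ (residues r).filter (fun a => IsCoprime a r),
    ∑ x ∈ Fintype.piFinset (fun _ : Fin 6 => residues r),
      psi (toKInf (a * cubicForm x - ∑ i, c i * x i) / toKInf r)

/-- The term `|r|^{-6} S_r(0)` of the singular series. -/
def singularTerm (r : F[X]) : ℂ := ((polyAbs r ^ 6)⁻¹ : ℝ) * expSum r 0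

/-- The singular series `𝔖 = ∑_r |r|^{-6} S_r(0)`, over all monic `r`. -/
def singularSeries (F : Type*) [Field F] [Fintype F] : ℂ :=
  ∑' r : {r : F[X] // r.Monic}, singularTerm r.1

/-! ### Integrals and the circle method expansion -/

/-- `Ã = ⌊α/3 + A⌋`. -/
def tildeA (A : ℝ) (α : ℕ) : ℤ := ⌊(α : ℝ) / 3 + A⌋

/-- The singular integral
`σ_∞ = ∫_{|θ| ≤ q^{4Ã}} ∫_{K_∞⁶} w(x) ψ(θ F(x)) dx dθ`, for `w = w_{A,α}`. -/
def singularIntegral (F : Type*) [Field F] [Fintype F] (A : ℝ) (α : ℕ) : ℂ :=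
  ∫ θ in {θ : KInf F | absInf θ ≤ (Fintype.card F : ℝ) ^ (4 * tildeA A α)},
    (∫ x, (weight A α x : ℂ) * psi (θ * cubicForm x) ∂(haarInf6 F)) ∂(haarInf F)

/-- The oscillatory integral
`I_r(c) = ∫_{|θ| < |r|⁻¹ q^{-Q}} ∫_{K_∞⁶} w(x) ψ(θ P³ F(x) + P c·x / r) dx dθ`. -/
def oscIntegral (w : (Fin 6 → KInf F) → ℝ) (P : KInf F) (Q : ℤ) (r : F[X])
    (c : Fin 6 → F[X]) : ℂ :=
  ∫ θ in {θ : KInf F | absInf θ < (polyAbs r)⁻¹ * (Fintype.card F : ℝ) ^ (-Q)},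
    (∫ x, (w x : ℂ) * psi (θ * P ^ 3 * cubicForm x + P * (∑ i, toKInf (c i) * x i) / toKInf r)
      ∂(haarInf6 F)) ∂(haarInf F)

/-- The contribution
`|P|⁶ ∑_{r monic, |r| ≤ q^Q} |r|^{-6} S_r(c) I_r(c)` of the vector `c` to the expression that the
circle method with parameter `Q` gives for `∑_{x ∈ 𝓞⁶, F(x) = 0} w(x/P)`. -/
def circleTerm (w : (Fin 6 → KInf F) → ℝ) (P : KInf F) (Q : ℤ) (c : Fin 6 → F[X]) : ℂ :=
  ((absInf P ^ 6 : ℝ) : ℂ) *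
    ∑ r ∈ monicUpTo F Q, ((polyAbs r ^ 6)⁻¹ : ℝ) * expSum r c * oscIntegral w P Q r c

/-- The choice `Q = ⌊-2Ã + 3d/2⌋`. -/
def paramQ (A : ℝ) (α : ℕ) (d : ℤ) : ℤ := ⌊-2 * (tildeA A α : ℝ) + 3 * (d : ℝ) / 2⌋

/-- `M(P)`, the contribution of `c = 0`, for `P = t^d`, `w = w_{A,α}` and `Q = ⌊-2Ã + 3d/2⌋`. -/
def centreTerm (F : Type*) [Field F] [Fintype F] (A : ℝ) (α : ℕ) (d : ℤ) : ℂ :=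
  circleTerm (weight A α) ((tInf : KInf F) ^ d) (paramQ A α d) 0

end Field

end CubicCircle

end

/-!
The error term is a tail of the singular series, because the singular integral takes no part in it.

*The singular integral.* The weight `w` is supported on `|x₁³ + x₂³ + x₃³| = q ^ α` and is invariant
under multiplication of `(x₁, x₂, x₃)` by a unit `u = 1 + μ t⁻ᵏ` with `k ≥ 1`.  Averaging
`ψ(θ F(x))` over `μ ∈ 𝔽_q`, for the `k` with `|θ| q ^ α = q ^ (k - 1)`, shows that
`∫ w(x) ψ(θ F(x)) dx` vanishes for `|θ| ≥ 1` (`integral_weight_mul_psi_eq_zero`).  For `|r| ≤ q ^ Q`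
the ranges of `θ` that define `σ_∞` and, after the substitution `θ ↦ P⁻³ θ`, `I_r(0)` both contain
`{|θ| < 1}`, so `I_r(0) = |P|⁻³ σ_∞` exactly (`oscIntegral_zero`), and `M(P)` is `σ_∞ |P|³` times a
partial sum of `𝔖` (`centreTerm_eq`).

*The singular series.* `S_r(0)` is the sum of the sixth powers of `∑_x ψ(a x³ / r)` over `a` coprime
to `r`.  If `p` is prime, then a factor `p³` of `r` contributes `|p|²` to this sum, a factor `p²`
exactly dividing `r` contributes `|p|` (both from completing `x ↦ x + (r / p) z`), and a factor `p`
exactly dividing `r` splits off by the Chinese remainder theorem and contributes `O(|p| ^ (1 / 2))`.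
The last bound comes from the second moment over `a`, which counts solutions of `x³ ≡ y³`, and the
invariance of the sum under `a ↦ a b³` (`norm_cubeSum_sq_le`).  Hence every monic `r` is `m³ n` with
`|r| ^ (-6) |S_r(0)| ≪ |m| ^ (-3) |n| ^ (-2 + δ)` (`exists_norm_cubeSum_le`), the series
`∑ |r| ^ (-6) |S_r(0)| |r| ^ σ` converges for `σ < 2 / 3`
(`summable_norm_singularTerm_mul_rpow`), and Rankin's trick bounds the tail
(`exists_norm_sum_singularTerm_sub_le`).
-/

open MeasureTheory Polynomial

noncomputable section

namespace CubicCircle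

/-! ### The additive character of `K_∞` -/

section Character

variable {F : Type*} [Field F] [Fintype F]

/-- The additive character `c ↦ exp(2πi Tr(c) / p)` of `𝔽_q`, through which `psi` factors. -/
def traceChar (F : Type*) [Field F] [Fintype F] : AddChar F ℂ :=
  letI : NeZero (ringChar F) := ⟨CharP.ringChar_ne_zero_of_finite F⟩
  letI : Algebra (ZMod (ringChar F)) F := ZMod.algebra F (ringChar F)
  (ZMod.stdAddChar (N := ringChar F)).compAddMonoidHom
    (Algebra.trace (ZMod (ringChar F)) F).toAddMonoidHom

theorem psi_eq_traceChar (γ : KInf F) : psi γ = traceChar F (γ.coeff 1) := rfl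

theorem psi_zero : psi (0 : KInf F) = 1 := by
  simp [psi_eq_traceChar]

theorem psi_add (γ δ : KInf F) : psi (γ + δ) = psi γ * psi δ := by
  simp [psi_eq_traceChar, AddChar.map_add_eq_mul]

theorem norm_psi (γ : KInf F) : ‖psi γ‖ = 1 := by
  rw [psi_eq_traceChar, AddChar.norm_apply]

theorem traceChar_isPrimitive : (traceChar F).IsPrimitive := by
  let _ : NeZero (ringChar F) := ⟨CharP.ringChar_ne_zero_of_finite F⟩
  let _ : Algebra (ZMod (ringChar F)) F := ZMod.algebra F (ringChar F)
  apply AddChar.IsPrimitive.of_ne_one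
  intro h
  have : Fact (ringChar F).Prime := ⟨CharP.char_is_prime F _⟩
  obtain ⟨b, hb⟩ := FiniteField.trace_to_zmod_nondegenerate F (one_ne_zero (α := F))
  have h1 : ZMod.stdAddChar (Algebra.trace (ZMod (ringChar F)) F (1 * b)) = (1 : ℂ) :=
    DFunLike.congr_fun h (1 * b)
  apply hb
  apply ZMod.injective_stdAddChar
  rw [h1, AddChar.map_zero_eq_one]

open Classical in
theorem sum_traceChar_mul (b : F) :
    ∑ x : F, traceChar F (x * b) = if b = 0 then (Fintype.card F : ℂ) else 0 := by
  rw [AddChar.sum_mulShift b traceChar_isPrimitive]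
  simp

end Character

/-! ### The absolute value of `K_∞` -/

section AbsoluteValue

variable {F : Type*} [Field F]

theorem tInf_zpow (d : ℤ) : (tInf : KInf F) ^ d = HahnSeries.single (-d) 1 := by
  rw [tInf, RatFunc.single_zpow (-1), RatFunc.single_zpow (-d), ← zpow_mul, neg_one_mul]

variable [Fintype F]

theorem one_lt_card_real (F : Type*) [Field F] [Fintype F] : (1 : ℝ) < Fintype.card F := by
  exact_mod_cast Fintype.one_lt_card

theorem card_real_pos (F : Type*) [Field F] [Fintype F] : (0 : ℝ) < Fintype.card F :=
  zero_lt_one.trans (one_lt_card_real F)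

@[simp] theorem absInf_zero : absInf (0 : KInf F) = 0 := by simp [absInf]

theorem absInf_of_ne_zero {γ : KInf F} (h : γ ≠ 0) :
    absInf γ = (Fintype.card F : ℝ) ^ (-γ.order) := by simp [absInf, h]

theorem absInf_nonneg (γ : KInf F) : 0 ≤ absInf γ := by
  unfold absInf; split_ifs <;> positivity

theorem absInf_mul (γ δ : KInf F) : absInf (γ * δ) = absInf γ * absInf δ := by
  by_cases h : γ = 0
  · simp [h]
  by_cases h' : δ = 0
  · simp [h']
  rw [absInf_of_ne_zero h, absInf_of_ne_zero h', absInf_of_ne_zero (mul_ne_zero h h'),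
    HahnSeries.order_mul h h', ← zpow_add₀ (card_real_pos F).ne']
  congr 1; ring

theorem absInf_single (n : ℤ) {c : F} (hc : c ≠ 0) :
    absInf (HahnSeries.single n c : KInf F) = (Fintype.card F : ℝ) ^ (-n) := by
  rw [absInf_of_ne_zero (by simpa using hc), HahnSeries.order_single hc]

@[simp] theorem absInf_one : absInf (1 : KInf F) = 1 := by
  simpa using absInf_single (F := F) 0 one_ne_zero

theorem absInf_inv (γ : KInf F) : absInf γ⁻¹ = (absInf γ)⁻¹ := by
  by_cases h : γ = 0
  · simp [h]
  refine eq_inv_of_mul_eq_one_left ?_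
  rw [← absInf_mul, inv_mul_cancel₀ h, absInf_one]

end AbsoluteValue

/-! ### Haar measure on `K_∞` under multiplication -/

section Haar

open scoped Pointwise NNReal

variable {F : Type*} [Field F]

/-- The element `t`, as a unit of `K_∞`. -/
def tUnit (F : Type*) [Field F] : (KInf F)ˣ :=
  Units.mk0 tInf (by simp [tInf])

theorem val_tUnit_zpow (n : ℤ) : (((tUnit F) ^ n : (KInf F)ˣ) : KInf F) = tInf ^ n := by
  rw [Units.val_zpow_eq_zpow_val]
  rfl

/-- Multiplication by a unit of `K_∞`, as a measurable equivalence. -/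
def mulMeasurableEquiv (u : (KInf F)ˣ) : KInf F ≃ᵐ KInf F :=
  (Homeomorph.smul u).toMeasurableEquiv

@[simp] theorem mulMeasurableEquiv_apply (u : (KInf F)ˣ) (γ : KInf F) :
    mulMeasurableEquiv u γ = u * γ := rfl

variable [Fintype F]

instance : (haarInf F).IsAddHaarMeasure := by unfold haarInf; infer_instance

instance : (haarInf F).Regular := by unfold haarInf; infer_instance

theorem haarInf_unitBall : haarInf F (unitBall F) = 1 :=
  Measure.addHaarMeasure_self (K₀ := unitBallCompacts F)

theorem zero_mem_unitBall : (0 : KInf F) ∈ unitBall F := by simp [unitBall]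

instance : LocallyCompactSpace (KInf F) :=
  (isCompact_unitBall F).locallyCompactSpace_of_mem_nhds_of_addGroup
    ((isOpen_unitBall F).mem_nhds zero_mem_unitBall)

theorem absInf_tInf_zpow (n : ℤ) : absInf ((tInf : KInf F) ^ n) = (Fintype.card F : ℝ) ^ n := by
  rw [tInf_zpow, absInf_single _ one_ne_zero, neg_neg]

theorem mem_smul_unitBall (u : (KInf F)ˣ) (γ : KInf F) :
    γ ∈ u • unitBall F ↔ absInf γ < absInf (u : KInf F) := by
  have hu : 0 < absInf (u : KInf F) := by
    rw [absInf_of_ne_zero u.ne_zero]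
    exact zpow_pos (card_real_pos F) _
  rw [Set.mem_smul_set_iff_inv_smul_mem, Units.smul_def, smul_eq_mul, unitBall, Set.mem_ofPred_eq,
    absInf_mul, Units.val_inv_eq_inv_val, absInf_inv, inv_mul_lt_iff₀ hu, mul_one]

instance : SigmaCompactSpace (KInf F) := by
  refine SigmaCompactSpace.of_countable (Set.range fun n : ℤ => (tUnit F) ^ n • unitBall F)
    (Set.countable_range _) ?_ ?_
  · rintro _ ⟨n, rfl⟩
    exact (isCompact_unitBall F).smul _
  · refine Set.eq_univ_of_forall fun γ => ?_
    obtain ⟨n, hn⟩ := pow_unbounded_of_one_lt (absInf γ) (one_lt_card_real F)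
    refine ⟨_, ⟨(n : ℤ), rfl⟩, ?_⟩
    rw [mem_smul_unitBall, val_tUnit_zpow, absInf_tInf_zpow]
    exact_mod_cast hn

theorem distribHaarChar_of_absInf_eq_one {u : (KInf F)ˣ} (hu : absInf (u : KInf F) = 1) :
    distribHaarChar (KInf F) u = 1 := by
  have h : u • unitBall F = unitBall F := by
    ext γ
    rw [mem_smul_unitBall, hu]
    rfl
  apply distribHaarChar_eq_of_measure_smul_eq_mul (μ := haarInf F) (s := unitBall F) <;>
    simp [haarInf_unitBall, h]

theorem mem_inv_smul_unitBall (γ : KInf F) :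
    γ ∈ (tUnit F)⁻¹ • unitBall F ↔ ∀ n : ℤ, n < 2 → γ.coeff n = 0 := by
  rw [Set.mem_inv_smul_set_iff, Units.smul_def, mem_unitBall_iff]
  have h (n : ℤ) : ((tUnit F : KInf F) • γ).coeff n = γ.coeff (n + 1) := by
    simp [tUnit, tInf, HahnSeries.coeff_single_mul]
  constructor
  · intro H n hn
    rw [← H (n - 1) (by omega), h, sub_add_cancel]
  · intro H n hn
    rw [h, H _ (by omega)]

/-- The unit ball is the disjoint union of `q` translates of `t⁻¹ 𝕋`, one for each coefficient
of `t⁻¹`. -/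
theorem distribHaarChar_tUnit : distribHaarChar (KInf F) (tUnit F) = Fintype.card F := by
  rw [← inv_inj, ← map_inv]
  set B : Set (KInf F) := (tUnit F)⁻¹ • unitBall F with hB
  have hBo : IsOpen B := (isOpen_unitBall F).smul _
  let T : F → Set (KInf F) := fun c => (fun γ => -HahnSeries.single (1 : ℤ) c + γ) ⁻¹' B
  have hT : unitBall F = ⋃ c, T c := by
    ext γ
    simp only [Set.mem_iUnion, T, Set.mem_preimage, hB, mem_inv_smul_unitBall, mem_unitBall_iff]
    constructor
    · intro h
      refine ⟨γ.coeff 1, fun n hn => ?_⟩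
      rcases eq_or_ne n 1 with rfl | h1
      · simp
      · simp [HahnSeries.coeff_single_of_ne h1, h n (by omega)]
    · rintro ⟨c, hc⟩ n hn
      have := hc n (by omega)
      simpa [HahnSeries.coeff_single_of_ne (show n ≠ 1 by omega)] using this
  have hd : Pairwise (Function.onFun Disjoint T) := by
    intro c c' hcc
    rw [Function.onFun, Set.disjoint_left]
    intro γ h1 h2
    simp only [T, Set.mem_preimage, hB, mem_inv_smul_unitBall] at h1 h2
    have h1 := h1 1 (by norm_num)
    have h2 := h2 1 (by norm_num)
    simp only [HahnSeries.coeff_add, HahnSeries.coeff_neg, HahnSeries.coeff_single_same] at h1 h2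
    exact hcc (by linear_combination h2 - h1)
  have hm : (Fintype.card F : ENNReal) * haarInf F B = 1 := by
    rw [← haarInf_unitBall (F := F), hT, measure_iUnion hd]
    · simp only [T, measure_preimage_add, tsum_fintype, Finset.sum_const, Finset.card_univ,
        nsmul_eq_mul]
    · intro c
      exact (hBo.preimage (by fun_prop)).measurableSet
  apply distribHaarChar_eq_of_measure_smul_eq_mul (μ := haarInf F) (s := unitBall F) <;>
    simp only [haarInf_unitBall, ne_eq, one_ne_zero, ENNReal.one_ne_top, not_false_eq_true]
  rw [mul_one, ENNReal.coe_inv (by simp), ENNReal.coe_natCast]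
  exact ENNReal.eq_inv_of_mul_eq_one_left (by rw [mul_comm]; exact hm)

theorem map_mul_haarInf (u : (KInf F)ˣ) :
    (haarInf F).map (mulMeasurableEquiv u) = (distribHaarChar (KInf F) u)⁻¹ • haarInf F := by
  ext s hs
  rw [MeasurableEquiv.map_apply]
  have : (mulMeasurableEquiv u) ⁻¹' s = u⁻¹ • s := by
    ext γ
    rw [Set.mem_inv_smul_set_iff]
    rfl
  rw [this, ← distribHaarChar_mul, map_inv]
  rfl

theorem measurePreserving_mul {u : (KInf F)ˣ} (hu : absInf (u : KInf F) = 1) :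
    MeasurePreserving (mulMeasurableEquiv u) (haarInf F) (haarInf F) where
  measurable := (mulMeasurableEquiv u).measurable
  map_eq := by rw [map_mul_haarInf, distribHaarChar_of_absInf_eq_one hu, inv_one, one_smul]

theorem integral_comp_tInf_zpow_mul (n : ℤ) (f : KInf F → ℂ) :
    ∫ θ, f (tInf ^ n * θ) ∂(haarInf F) =
      (((Fintype.card F : ℝ) ^ n)⁻¹ : ℝ) * ∫ θ, f θ ∂(haarInf F) := by
  have h := integral_map_equiv (μ := haarInf F) (mulMeasurableEquiv (tUnit F ^ n)) f
  simp only [mulMeasurableEquiv_apply, val_tUnit_zpow] at h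
  rw [← h, map_mul_haarInf, integral_smul_nnreal_measure, map_zpow, distribHaarChar_tUnit,
    NNReal.smul_def, Complex.real_smul]
  simp

end Haar

/-! ### The oscillatory integral of the centre term -/

section Oscillatory

variable {F : Type*} [Field F]

/-- Multiplication of the first three coordinates of `K_∞⁶` by a unit. -/
def scaleFirstThree (u : (KInf F)ˣ) : (Fin 6 → KInf F) ≃ᵐ (Fin 6 → KInf F) :=
  MeasurableEquiv.piCongrRight fun i : Fin 6 => mulMeasurableEquiv (if i < 3 then u else 1)

theorem scaleFirstThree_apply (u : (KInf F)ˣ) (x : Fin 6 → KInf F) (i : Fin 6) :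
    scaleFirstThree u x i = (if i < 3 then u else 1 : (KInf F)ˣ) * x i := rfl

theorem cubicForm_scaleFirstThree (u : (KInf F)ˣ) (x : Fin 6 → KInf F) :
    cubicForm (scaleFirstThree u x) =
      cubicForm x + (x 0 ^ 3 + x 1 ^ 3 + x 2 ^ 3) * ((u : KInf F) ^ 3 - 1) := by
  simp [cubicForm, scaleFirstThree_apply, Fin.sum_univ_six, show ¬ (5 : Fin 6) < 3 by decide,
    show ¬ (4 : Fin 6) < 3 by decide, show (1 : Fin 6) < 3 by decide,
    show (2 : Fin 6) < 3 by decide]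
  ring

variable [Fintype F]

theorem measurePreserving_scaleFirstThree {u : (KInf F)ˣ} (hu : absInf (u : KInf F) = 1) :
    MeasurePreserving (scaleFirstThree u) (haarInf6 F) (haarInf6 F) := by
  refine measurePreserving_pi (fun _ : Fin 6 => haarInf F) (fun _ => haarInf F) fun i =>
    measurePreserving_mul ?_
  split_ifs
  · exact hu
  · simp

theorem nu_mul {u : KInf F} (hu : absInf u = 1) (A : ℝ) (α : ℕ) (x y z : KInf F) :
    nu A α (u * x) (u * y) (u * z) = nu A α x y z := by
  have h : (u * x) ^ 3 + (u * y) ^ 3 + (u * z) ^ 3 = u ^ 3 * (x ^ 3 + y ^ 3 + z ^ 3) := by ring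
  have h3 : absInf (u ^ 3) = 1 := by simp [pow_succ, absInf_mul, hu]
  simp only [nu, h, absInf_mul, hu, h3, one_mul]

theorem weight_scaleFirstThree {u : (KInf F)ˣ} (hu : absInf (u : KInf F) = 1) (A : ℝ) (α : ℕ)
    (x : Fin 6 → KInf F) : weight A α (scaleFirstThree u x) = weight A α x := by
  have h := nu_mul hu A α (x 0) (x 1) (x 2)
  simp [weight, scaleFirstThree_apply, h, show ¬ (5 : Fin 6) < 3 by decide,
    show ¬ (4 : Fin 6) < 3 by decide, show (1 : Fin 6) < 3 by decide,
    show (2 : Fin 6) < 3 by decide]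

theorem absInf_of_weight_ne_zero {A : ℝ} {α : ℕ} {x : Fin 6 → KInf F} (h : weight A α x ≠ 0) :
    absInf (x 0 ^ 3 + x 1 ^ 3 + x 2 ^ 3) = (Fintype.card F : ℝ) ^ α := by
  by_contra h'
  exact h (by simp [weight, nu, h'])

theorem exists_unit_one_add_single {k : ℤ} (hk : 1 ≤ k) (μ : F) :
    ∃ u : (KInf F)ˣ, (u : KInf F) = 1 + HahnSeries.single k μ ∧ absInf (u : KInf F) = 1 := by
  have h0 : (1 + HahnSeries.single k μ : KInf F).coeff 0 = 1 := by
    rw [HahnSeries.coeff_add, HahnSeries.coeff_single_of_ne (by omega), HahnSeries.coeff_one]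
    simp
  have hne : (1 + HahnSeries.single k μ : KInf F) ≠ 0 := by
    intro h
    simp [h] at h0
  refine ⟨Units.mk0 _ hne, rfl, ?_⟩
  have ho : (1 + HahnSeries.single k μ : KInf F).order = 0 := by
    apply le_antisymm
    · exact HahnSeries.order_le_of_coeff_ne_zero (by rw [h0]; exact one_ne_zero)
    · refine (HahnSeries.le_order_iff_forall hne).mpr fun j hj => ?_
      rw [HahnSeries.coeff_add, HahnSeries.coeff_one, HahnSeries.coeff_single_of_ne (by omega),
        if_neg hj.ne, add_zero]
  rw [Units.val_mk0, absInf_of_ne_zero hne, ho, neg_zero, zpow_zero]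

/-- With `s = 1 / t`: if `k = 1 - ord γ ≥ 1`, then `ψ(γ ((1 + μ s ^ k)³ - 1))` only depends on `μ` through
the linear term `3 μ s ^ k`, as the quadratic and cubic terms are too small. -/
theorem psi_mul_cube_sub_one {γ : KInf F} {k : ℤ} (hk : 1 ≤ k) (hγ : γ.order = 1 - k) (μ : F) :
    psi (γ * ((1 + HahnSeries.single k μ) ^ 3 - 1)) = traceChar F (μ * (3 * γ.coeff (1 - k))) := by
  have h : γ * ((1 + HahnSeries.single k μ) ^ 3 - 1) =
      HahnSeries.single k (3 * μ) * γ + HahnSeries.single (k + k) (3 * (μ * μ)) * γ +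
        HahnSeries.single (k + k + k) (μ * μ * μ) * γ := by
    have h3 (n : ℤ) (c : F) :
        (HahnSeries.single n (3 * c) : KInf F) = 3 * HahnSeries.single n c := by
      rw [show 3 * c = c + c + c by ring, HahnSeries.single_add, HahnSeries.single_add]
      ring
    rw [h3, h3, ← HahnSeries.single_mul_single, ← HahnSeries.single_mul_single,
      ← HahnSeries.single_mul_single]
    ring
  rw [psi_eq_traceChar, h, HahnSeries.coeff_add, HahnSeries.coeff_add, HahnSeries.coeff_single_mul,
    HahnSeries.coeff_single_mul, HahnSeries.coeff_single_mul,
    HahnSeries.coeff_eq_zero_of_lt_order (i := 1 - (k + k)) (by omega),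
    HahnSeries.coeff_eq_zero_of_lt_order (i := 1 - (k + k + k)) (by omega)]
  congr 1
  ring

/-- The Fourier transform `θ ↦ ∫ w(x) ψ(θ F(x)) dx` vanishes for `|θ| ≥ 1`.  The weight is
invariant under multiplication of `(x₁, x₂, x₃)` by `1 + μ s ^ k` for `s = 1 / t` and `k ≥ 1`; for
`q ^ k = q |θ| q ^ α` the average of `ψ(θ F)` over `μ ∈ 𝔽_q` is zero on the support of the weight,
since `|x₁³ + x₂³ + x₃³| = q ^ α` there. -/
theorem integral_weight_mul_psi_eq_zero (h3 : (3 : F) ≠ 0) (A : ℝ) (α : ℕ) {θ : KInf F}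
    (hθ : 1 ≤ absInf θ) :
    ∫ x, (weight A α x : ℂ) * psi (θ * cubicForm x) ∂(haarInf6 F) = 0 := by
  have hθ0 : θ ≠ 0 := by
    rintro rfl
    norm_num at hθ
  have hord : θ.order ≤ 0 := by
    rw [absInf_of_ne_zero hθ0, one_le_zpow_iff_right₀ (one_lt_card_real F)] at hθ
    omega
  set f : (Fin 6 → KInf F) → ℂ := fun x => (weight A α x : ℂ) * psi (θ * cubicForm x) with hf
  -- `θ (x₁³ + x₂³ + x₃³)` has order `1 - k` on the support of the weight, so that its product with
  -- `s ^ k` has order `1`, the index of the coefficient that `ψ` reads.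
  set k : ℤ := 1 - (θ.order - α) with hk
  have hk1 : 1 ≤ k := by omega
  choose u hu hu1 using exists_unit_one_add_single (F := F) hk1
  have hmp (μ : F) := measurePreserving_scaleFirstThree (hu1 μ)
  have hsum : ∀ x, ∑ μ : F, f (scaleFirstThree (u μ) x) = 0 := by
    intro x
    by_cases hw : weight A α x = 0
    · simp [hf, weight_scaleFirstThree (hu1 _), hw]
    have habs := absInf_of_weight_ne_zero hw
    set G := x 0 ^ 3 + x 1 ^ 3 + x 2 ^ 3 with hG
    have hG0 : G ≠ 0 := by
      intro h
      rw [h, absInf_zero] at habs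
      exact (pow_pos (card_real_pos F) α).ne habs
    have hGord : G.order = -α := by
      rw [absInf_of_ne_zero hG0, ← zpow_natCast] at habs
      have := zpow_right_injective₀ (card_real_pos F) (one_lt_card_real F).ne' habs
      omega
    have hord' : (θ * G).order = 1 - k := by
      rw [HahnSeries.order_mul hθ0 hG0, hGord]
      omega
    have hlead : 3 * (θ * G).coeff (1 - k) ≠ 0 := by
      rw [← hord']
      exact mul_ne_zero h3 (HahnSeries.coeff_order_eq_zero.not.mpr (mul_ne_zero hθ0 hG0))
    have hterm (μ : F) : f (scaleFirstThree (u μ) x) =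
        f x * traceChar F (μ * (3 * (θ * G).coeff (1 - k))) := by
      simp only [hf]
      rw [weight_scaleFirstThree (hu1 μ), cubicForm_scaleFirstThree, ← hG, hu, mul_add, psi_add,
        ← mul_assoc θ G, psi_mul_cube_sub_one hk1 hord', mul_assoc]
    simp only [hterm, ← Finset.mul_sum, sum_traceChar_mul, if_neg hlead, mul_zero]
  -- Integrability of `f` only serves to exchange the integral with the finite sum over `μ`; without
  -- it the Bochner integral would be `0` by convention, so it need not be established.
  by_cases hint : Integrable f (haarInf6 F)
  · have h1 : ∑ μ : F, ∫ x, f (scaleFirstThree (u μ) x) ∂(haarInf6 F) = 0 := by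
      rw [← integral_finsetSum]
      · simp [hsum]
      · exact fun μ _ => (hmp μ).integrable_comp_of_integrable hint
    simp only [fun μ => (hmp μ).integral_comp' f, Finset.sum_const, Finset.card_univ,
      nsmul_eq_mul, mul_eq_zero, Nat.cast_eq_zero, Fintype.card_ne_zero, false_or] at h1
    exact h1
  · exact integral_undef hint

theorem singularIntegral_eq_integral (h3 : (3 : F) ≠ 0) {A : ℝ} (hA : 0 ≤ A) (α : ℕ) :
    singularIntegral F A α =
      ∫ θ, ∫ x, (weight A α x : ℂ) * psi (θ * cubicForm x) ∂(haarInf6 F) ∂(haarInf F) := by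
  refine setIntegral_eq_integral_of_forall_compl_eq_zero fun θ hθ => ?_
  apply integral_weight_mul_psi_eq_zero h3
  rw [Set.mem_ofPred_eq, not_le] at hθ
  refine le_trans ?_ hθ.le
  have : 0 ≤ tildeA A α := Int.floor_nonneg.mpr (by positivity)
  exact one_le_zpow₀ (one_lt_card_real F).le (by omega)

/-- Since `2 Q ≤ -4 Ã + 3 d`, for `|r| ≤ q ^ Q` the range of `θ` in `I_r(0)` contains the support of
the Fourier transform of the weight, scaled by `P⁻³`. -/
theorem oscIntegral_zero (h3 : (3 : F) ≠ 0) {A : ℝ} (hA : 0 ≤ A) (α : ℕ) (d : ℤ) {r : F[X]}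
    (hr : r.Monic) (hrQ : (r.natDegree : ℤ) ≤ paramQ A α d) :
    oscIntegral (weight A α) ((tInf : KInf F) ^ d) (paramQ A α d) r 0 =
      (((absInf ((tInf : KInf F) ^ d) ^ 3)⁻¹ : ℝ) : ℂ) * singularIntegral F A α := by
  have hP (θ : KInf F) : θ * (tInf ^ d) ^ 3 = tInf ^ (d * 3) * θ := by
    rw [mul_comm, ← zpow_natCast, ← zpow_mul]
    rfl
  rw [singularIntegral_eq_integral h3 hA, absInf_tInf_zpow, ← zpow_natCast, ← zpow_mul]
  simp only [oscIntegral, Pi.zero_apply, map_zero, zero_mul, Finset.sum_const_zero, mul_zero,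
    zero_div, add_zero, hP]
  rw [setIntegral_eq_integral_of_forall_compl_eq_zero]
  · exact integral_comp_tInf_zpow_mul (d * 3)
      fun θ => ∫ x, (weight A α x : ℂ) * psi (θ * cubicForm x) ∂(haarInf6 F)
  intro θ hθ
  apply integral_weight_mul_psi_eq_zero h3
  rw [Set.mem_ofPred_eq, not_lt, polyAbs, if_neg hr.ne_zero, ← zpow_natCast, ← zpow_neg,
    ← zpow_add₀ (card_real_pos F).ne'] at hθ
  rw [absInf_mul, absInf_tInf_zpow]
  have hA4 : 0 ≤ tildeA A α := Int.floor_nonneg.mpr (by positivity)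
  have hQ : 2 * paramQ A α d ≤ -4 * tildeA A α + 3 * d := by
    have := Int.floor_le (-2 * (tildeA A α : ℝ) + 3 * (d : ℝ) / 2)
    rw [paramQ]
    have h2 : (2 * ⌊-2 * (tildeA A α : ℝ) + 3 * (d : ℝ) / 2⌋ : ℝ) ≤
        -4 * tildeA A α + 3 * d := by linarith
    exact_mod_cast h2
  calc (1 : ℝ) ≤ (Fintype.card F : ℝ) ^ (d * 3 + (-(r.natDegree : ℤ) + -paramQ A α d)) :=
        one_le_zpow₀ (one_lt_card_real F).le (by omega)
    _ = (Fintype.card F : ℝ) ^ (d * 3) *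
          (Fintype.card F : ℝ) ^ (-(r.natDegree : ℤ) + -paramQ A α d) :=
        zpow_add₀ (card_real_pos F).ne' _ _
    _ ≤ _ := by gcongr

end Oscillatory

/-! ### Complete residue systems in `𝔽_q[t]` -/

section Residues

variable {F : Type*} [Field F]

theorem dvd_sub_mod (r x : F[X]) : r ∣ x - x % r :=
  ⟨x / r, by rw [sub_eq_iff_eq_add', EuclideanDomain.mod_add_div]⟩

variable [Fintype F]

theorem mem_residues {r x : F[X]} : x ∈ residues r ↔ x.degree < r.degree := by
  simp [residues]

theorem mod_mem_residues {r : F[X]} (hr : r ≠ 0) (x : F[X]) : x % r ∈ residues r :=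
  mem_residues.mpr (EuclideanDomain.mod_lt x hr)

theorem zero_mem_residues {r : F[X]} (hr : r ≠ 0) : (0 : F[X]) ∈ residues r := by
  rw [mem_residues, degree_zero, bot_lt_iff_ne_bot]
  exact degree_ne_bot.mpr hr

theorem eq_of_mem_residues {r x y : F[X]} (hx : x ∈ residues r) (hy : y ∈ residues r)
    (h : r ∣ x - y) : x = y := by
  rw [mem_residues] at hx hy
  refine sub_eq_zero.mp (eq_zero_of_dvd_of_degree_lt h ?_)
  exact (degree_sub_le x y).trans_lt (max_lt hx hy)

theorem card_residues {r : F[X]} (hr : r ≠ 0) :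
    (residues r).card = Fintype.card F ^ r.natDegree := by
  have h : ((residues r : Finset F[X]) : Set F[X]) = (degreeLT F r.natDegree : Set F[X]) := by
    ext x
    rw [Finset.mem_coe, mem_residues, SetLike.mem_coe, mem_degreeLT, degree_eq_natDegree hr]
  rw [← Set.ncard_coe_finset, h, ← Nat.card_coe_set_eq]
  change Nat.card (degreeLT F r.natDegree) = _
  rw [Nat.card_congr (degreeLTEquiv F r.natDegree).toEquiv]
  simp

theorem card_residues_eq_polyAbs {r : F[X]} (hr : r ≠ 0) :
    ((residues r).card : ℝ) = polyAbs r := by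
  rw [card_residues hr, polyAbs, if_neg hr, Nat.cast_pow]

theorem polyAbs_mul (r s : F[X]) : polyAbs (r * s) = polyAbs r * polyAbs s := by
  by_cases hr : r = 0
  · simp [polyAbs, hr]
  by_cases hs : s = 0
  · simp [polyAbs, hs]
  simp [polyAbs, hr, hs, natDegree_mul, pow_add]

theorem polyAbs_pow (r : F[X]) (n : ℕ) : polyAbs (r ^ n) = polyAbs r ^ n := by
  induction n with
  | zero => simp [polyAbs]
  | succ n ih => rw [pow_succ, polyAbs_mul, ih, pow_succ]

theorem polyAbs_of_ne_zero {r : F[X]} (hr : r ≠ 0) :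
    polyAbs r = (Fintype.card F : ℝ) ^ r.natDegree := by simp [polyAbs, hr]

theorem one_le_polyAbs {r : F[X]} (hr : r ≠ 0) : 1 ≤ polyAbs r := by
  rw [polyAbs_of_ne_zero hr]
  exact one_le_pow₀ (one_lt_card_real F).le

theorem polyAbs_pos {r : F[X]} (hr : r ≠ 0) : 0 < polyAbs r :=
  zero_lt_one.trans_le (one_le_polyAbs hr)

theorem sum_residues_mul {r s : F[X]} (hr : r ≠ 0) (hs : s ≠ 0) (f : F[X] → ℂ) :
    ∑ x ∈ residues (r * s), f x = ∑ y ∈ residues r, ∑ z ∈ residues s, f (y + r * z) := by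
  rw [← Finset.sum_product' (residues r) (residues s) fun y z => f (y + r * z)]
  refine Finset.sum_nbij' (fun x => (x % r, x / r)) (fun p => p.1 + r * p.2) ?_ ?_ ?_ ?_ ?_
  · intro x hx
    rw [mem_residues, degree_mul] at hx
    rw [Finset.mem_product]
    refine ⟨mod_mem_residues hr x, ?_⟩
    rw [mem_residues]
    by_cases h : x / r = 0
    · rw [h, degree_zero, bot_lt_iff_ne_bot]
      exact degree_ne_bot.mpr hs
    · have hdeg : r.degree ≤ x.degree := by
        by_contra hlt
        exact h ((Polynomial.div_eq_zero_iff hr).mpr (not_le.mp hlt))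
      rw [← degree_add_div hr hdeg] at hx
      exact lt_of_add_lt_add_left hx
  · rintro ⟨y, z⟩ hp
    rw [Finset.mem_product, mem_residues, mem_residues] at hp
    rw [mem_residues]
    refine (degree_add_le _ _).trans_lt (max_lt (hp.1.trans_le ?_) ?_)
    · rw [degree_mul]
      have : 0 ≤ s.degree := zero_le_degree_iff.mpr hs
      exact le_add_of_nonneg_right this
    · rw [degree_mul, degree_mul]
      exact WithBot.add_lt_add_left (degree_ne_bot.mpr hr) hp.2
  · intro x _
    exact EuclideanDomain.mod_add_div x r
  · rintro ⟨y, z⟩ hp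
    rw [Finset.mem_product, mem_residues, mem_residues] at hp
    have h1 : (y + r * z) % r = y := by
      rw [Polynomial.add_mod, EuclideanDomain.mod_eq_zero.mpr (dvd_mul_right r z), add_zero]
      exact mod_eq_self_iff hr |>.mpr hp.1
    have h2 : (y + r * z) / r = z := by
      have := EuclideanDomain.mod_add_div (y + r * z) r
      rw [h1] at this
      exact mul_left_cancel₀ hr (add_left_cancel this)
    simp only [h1, h2]
  · intro x _
    rw [EuclideanDomain.mod_add_div]

/-- A sum over residues of a function that is periodic modulo `r` is not changed by a substitution
that is injective modulo `r`. -/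
theorem sum_residues_comp {r : F[X]} (hr : r ≠ 0) {f : F[X] → ℂ}
    (hf : ∀ x y, r ∣ x - y → f x = f y) {φ : F[X] → F[X]}
    (hφ : ∀ x y, r ∣ φ x - φ y → r ∣ x - y) :
    ∑ x ∈ residues r, f (φ x) = ∑ x ∈ residues r, f x := by
  have hinj : Set.InjOn (fun x => φ x % r) (residues r : Set F[X]) := by
    intro x hx y hy hxy
    refine eq_of_mem_residues hx hy (hφ x y ?_)
    simp only at hxy
    have h := dvd_sub (dvd_sub_mod r (φ x)) (dvd_sub_mod r (φ y))
    rwa [hxy, sub_sub_sub_cancel_right] at h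
  refine Finset.sum_nbij (fun x => φ x % r) (fun x _ => mod_mem_residues hr _) hinj ?_ ?_
  · exact Finset.surjOn_of_injOn_of_card_le _ (fun x _ => mod_mem_residues hr _) hinj le_rfl
  · exact fun x _ => hf _ _ (dvd_sub_mod r _)

end Residues

/-! ### The additive characters of `𝔽_q[t] / r` -/

section PolyChar

variable {F : Type*} [Field F]

theorem coeff_toKInf (b : F[X]) (n : ℤ) :
    (toKInf b).coeff n = if n ≤ 0 then b.coeff (-n).toNat else 0 := by
  induction b using Polynomial.induction_on' with
  | add p q hp hq =>
    rw [map_add, HahnSeries.coeff_add, hp, hq]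
    split_ifs <;> simp
  | monomial i c =>
    have h : toKInf (monomial i c) = HahnSeries.single (-(i : ℤ)) c := by
      change aeval (tInf : KInf F) (monomial i c) = _
      rw [aeval_monomial, ← zpow_natCast, tInf_zpow,
        LaurentSeries.algebraMap_apply, HahnSeries.C_apply,
        HahnSeries.single_mul_single]
      simp
    rw [h, HahnSeries.coeff_single, coeff_monomial]
    split_ifs <;> first | rfl | omega

theorem toKInf_ne_zero {b : F[X]} (hb : b ≠ 0) : toKInf b ≠ 0 := by
  intro h
  have h1 := coeff_toKInf b (-(b.natDegree : ℤ))
  rw [h, if_pos (by omega)] at h1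
  exact hb (leadingCoeff_eq_zero.mp (by simpa using h1.symm))

theorem order_toKInf {b : F[X]} (hb : b ≠ 0) : (toKInf b).order = -(b.natDegree : ℤ) := by
  apply le_antisymm
  · apply HahnSeries.order_le_of_coeff_ne_zero
    rw [coeff_toKInf, if_pos (by omega)]
    simpa using hb
  · refine (HahnSeries.le_order_iff_forall (toKInf_ne_zero hb)).mpr fun j hj => ?_
    rw [coeff_toKInf]
    split_ifs
    · exact coeff_eq_zero_of_natDegree_lt (by omega)
    · rfl

variable [Fintype F]

/-- The additive character `b ↦ ψ(b / r)` of `𝔽_q[t]`, which is periodic modulo `r`. -/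
def polyChar (r b : F[X]) : ℂ := psi (toKInf b / toKInf r)

@[simp] theorem polyChar_zero (r : F[X]) : polyChar r 0 = 1 := by
  simp [polyChar, psi_zero]

theorem polyChar_add (r b c : F[X]) : polyChar r (b + c) = polyChar r b * polyChar r c := by
  rw [polyChar, map_add, add_div, psi_add]
  rfl

theorem polyChar_neg (r b : F[X]) : polyChar r (-b) = star (polyChar r b) := by
  rw [polyChar, map_neg, neg_div, psi_eq_traceChar, HahnSeries.coeff_neg, AddChar.map_neg_eq_conj]
  rfl

theorem polyChar_mul_right {s : F[X]} (hs : s ≠ 0) (r b : F[X]) :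
    polyChar (r * s) (b * s) = polyChar r b := by
  rw [polyChar, map_mul, map_mul, mul_div_mul_right _ _ (toKInf_ne_zero hs)]
  rfl

theorem polyChar_of_dvd {r b : F[X]} (hr : r ≠ 0) (h : r ∣ b) : polyChar r b = 1 := by
  obtain ⟨c, rfl⟩ := h
  rw [polyChar, map_mul, mul_div_cancel_left₀ _ (toKInf_ne_zero hr), psi_eq_traceChar,
    coeff_toKInf, if_neg (by norm_num), AddChar.map_zero_eq_one]

theorem polyChar_congr {r b c : F[X]} (hr : r ≠ 0) (h : r ∣ b - c) :
    polyChar r b = polyChar r c := by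
  rw [← sub_add_cancel b c, polyChar_add, polyChar_of_dvd hr h, one_mul]

/-- The residue `b % r` is a nonzero polynomial of degree less than `deg r`; multiplying it by a
suitable monomial makes `1 / t` the leading term of the quotient by `r`. -/
theorem exists_polyChar_mul_ne_one {r b : F[X]} (hr : r ≠ 0) (h : ¬ r ∣ b) :
    ∃ z, polyChar r (b * z) ≠ 1 := by
  set c := b % r with hc
  have hc0 : c ≠ 0 := fun h0 => h ((EuclideanDomain.mod_eq_zero).mp h0)
  have hdeg : c.natDegree < r.natDegree :=
    natDegree_lt_natDegree hc0 (EuclideanDomain.mod_lt b hr)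
  set γ := toKInf c / toKInf r with hγ
  have hγ0 : γ ≠ 0 := div_ne_zero (toKInf_ne_zero hc0) (toKInf_ne_zero hr)
  have hord : γ.order = r.natDegree - c.natDegree := by
    have h1 : γ * toKInf r = toKInf c := div_mul_cancel₀ _ (toKInf_ne_zero hr)
    have h2 := HahnSeries.order_mul hγ0 (toKInf_ne_zero hr)
    rw [h1, order_toKInf hc0, order_toKInf hr] at h2
    omega
  set k : ℕ := r.natDegree - c.natDegree - 1 with hk
  by_contra! hall
  have hone : ∀ e : F, traceChar F (e * γ.coeff γ.order) = 1 := by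
    intro e
    have h1 : polyChar r (b * (monomial k e)) = polyChar r (c * monomial k e) := by
      apply polyChar_congr hr
      rw [← sub_mul]
      exact (dvd_sub_mod r b).mul_right _
    have hm : toKInf (monomial k e) = HahnSeries.single (-(k : ℤ)) e := by
      ext n
      rw [coeff_toKInf, HahnSeries.coeff_single, coeff_monomial]
      split_ifs <;> first | rfl | omega
    rw [hall, polyChar, map_mul, mul_comm, mul_div_assoc, ← hγ, psi_eq_traceChar, hm,
      HahnSeries.coeff_single_mul] at h1
    rw [h1, hord]
    congr 3
    omega
  have hsum := sum_traceChar_mul (γ.coeff γ.order)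
  rw [if_neg (HahnSeries.coeff_order_eq_zero.not.mpr hγ0)] at hsum
  simp [hone] at hsum

open Classical in
theorem sum_polyChar_mul {r : F[X]} (hr : r ≠ 0) (b : F[X]) :
    ∑ z ∈ residues r, polyChar r (b * z) = if r ∣ b then ((residues r).card : ℂ) else 0 := by
  split_ifs with h
  · rw [Finset.sum_congr rfl fun z _ => polyChar_of_dvd hr (h.mul_right z)]
    simp
  · obtain ⟨c, hc⟩ := exists_polyChar_mul_ne_one hr h
    have h1 := sum_residues_comp hr (f := fun z => polyChar r (b * z)) (φ := fun z => z + c)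
      (fun x y hxy => polyChar_congr hr (by rw [← mul_sub]; exact hxy.mul_left b))
      (fun x y hxy => by simpa using hxy)
    simp only [mul_add, polyChar_add, ← Finset.sum_mul] at h1
    have h2 : (∑ z ∈ residues r, polyChar r (b * z)) * (polyChar r (b * c) - 1) = 0 := by
      rw [mul_sub, h1, mul_one, sub_self]
    exact (mul_eq_zero.mp h2).resolve_right (sub_ne_zero.mpr hc)

end PolyChar

/-! ### Cubic exponential sums -/

section CubeSum

variable {F : Type*} [Field F]

theorem dvd_sub_of_dvd_mul_sub {r c x y : F[X]} (hc : IsCoprime c r) (h : r ∣ c * x - c * y) :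
    r ∣ x - y := by
  rw [← mul_sub] at h
  exact hc.symm.dvd_of_dvd_mul_left h

variable [Fintype F]

/-- The cubic exponential sum `∑_{|x| < |r|} ψ(a x³ / r)`. -/
def cubeSum (r a : F[X]) : ℂ := ∑ x ∈ residues r, polyChar r (a * x ^ 3)

open Classical in
theorem expSum_zero_eq_sum_cubeSum (r : F[X]) :
    expSum r 0 = ∑ a ∈ (residues r).filter (fun a => IsCoprime a r), cubeSum r a ^ 6 := by
  unfold expSum
  refine Finset.sum_congr (by congr) fun a _ => ?_
  have h6 : cubeSum r a ^ 6 = ∏ _i : Fin 6, cubeSum r a := by simp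
  rw [h6]
  unfold cubeSum
  rw [Finset.prod_univ_sum]
  refine Finset.sum_congr rfl fun x _ => ?_
  have h (s : Finset (Fin 6)) : polyChar r (∑ i ∈ s, a * x i ^ 3) =
      ∏ i ∈ s, polyChar r (a * x i ^ 3) := by
    induction s using Finset.cons_induction with
    | empty => simp
    | cons i s hi ih => rw [Finset.sum_cons, Finset.prod_cons, polyChar_add, ih]
  rw [← h, ← Finset.mul_sum]
  simp [polyChar, cubicForm]

theorem polyChar_mul_cube_congr {r : F[X]} (hr : r ≠ 0) (a : F[X]) (x y : F[X])
    (h : r ∣ x - y) : polyChar r (a * x ^ 3) = polyChar r (a * y ^ 3) := by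
  apply polyChar_congr hr
  rw [← mul_sub]
  exact (h.trans (sub_dvd_pow_sub_pow x y 3)).mul_left a

theorem cubeSum_congr {r a b : F[X]} (hr : r ≠ 0) (h : r ∣ a - b) :
    cubeSum r a = cubeSum r b :=
  Finset.sum_congr rfl fun x _ => polyChar_congr hr (by rw [← sub_mul]; exact h.mul_right _)

theorem cubeSum_mul_cube {r : F[X]} (hr : r ≠ 0) {b : F[X]} (hb : IsCoprime b r) (a : F[X]) :
    cubeSum r (a * b ^ 3) = cubeSum r a := by
  have h := sum_residues_comp hr (polyChar_mul_cube_congr hr a) (φ := fun x => b * x)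
    fun x y => dvd_sub_of_dvd_mul_sub hb
  unfold cubeSum
  rw [← h]
  refine Finset.sum_congr rfl fun x _ => ?_
  rw [mul_pow, mul_assoc]

theorem cubeSum_mul_mul {u s : F[X]} (hu : u ≠ 0) (hs : s ≠ 0) (a : F[X]) :
    cubeSum (u * s) (a * s) = (residues s).card * cubeSum u a := by
  unfold cubeSum
  rw [sum_residues_mul hu hs, Finset.mul_sum]
  refine Finset.sum_congr rfl fun y _ => ?_
  rw [← nsmul_eq_mul, ← Finset.sum_const]
  refine Finset.sum_congr rfl fun z _ => ?_
  rw [mul_right_comm, polyChar_mul_right hs]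
  exact polyChar_mul_cube_congr hu a _ _ (by simp)

/-- Writing `x = y + p u z`, the sum over `z` modulo `p` vanishes unless `p` divides `y`. -/
theorem cubeSum_sq_mul (h3 : (3 : F) ≠ 0) {p u a : F[X]} (hp : Irreducible p) (hu : u ≠ 0)
    (ha : IsCoprime a p) :
    cubeSum (p ^ 2 * u) a = (residues p).card * cubeSum u (a * p) := by
  classical
  have hp0 := hp.ne_zero
  have hr : p ^ 2 * u = p * u * p := by ring
  have hr0 : p * u * p ≠ 0 := by simp [hp0, hu]
  have hinner (y : F[X]) : ∑ z ∈ residues p, polyChar (p * u * p) (a * (y + p * u * z) ^ 3) =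
      if p ∣ y then (residues p).card * polyChar (p * u * p) (a * y ^ 3) else 0 := by
    have hz (z : F[X]) : polyChar (p * u * p) (a * (y + p * u * z) ^ 3) =
        polyChar (p * u * p) (a * y ^ 3) * polyChar p (3 * a * y ^ 2 * z) := by
      have h1 : polyChar p (3 * a * y ^ 2 * z) =
          polyChar (p * u * p) (3 * a * y ^ 2 * z * (p * u)) := by
        rw [mul_comm (p * u) p, polyChar_mul_right (mul_ne_zero hp0 hu)]
      rw [h1, ← polyChar_add]
      exact polyChar_congr hr0 ⟨a * (3 * y * u * z ^ 2 + p * u ^ 2 * z ^ 3), by ring⟩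
    have hdvd : p ∣ 3 * a * y ^ 2 ↔ p ∣ y := by
      have hpr := hp.prime
      constructor
      · intro h
        have h3u : IsUnit (3 : F[X]) := by
          rw [← map_ofNat C 3]
          exact isUnit_C.mpr (isUnit_iff_ne_zero.mpr h3)
        rcases hpr.dvd_or_dvd h with h | h
        · rcases hpr.dvd_or_dvd h with h | h
          · exact absurd (isUnit_of_dvd_unit h h3u) hp.not_isUnit
          · exact absurd (ha.symm.isUnit_of_dvd' dvd_rfl h) hp.not_isUnit
        · exact hpr.dvd_of_dvd_pow h
      · intro h
        exact (h.trans (dvd_pow_self y two_ne_zero)).mul_left _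
    simp only [hz, ← Finset.mul_sum, sum_polyChar_mul hp0, hdvd]
    split_ifs <;> ring
  unfold cubeSum
  rw [hr, sum_residues_mul (mul_ne_zero hp0 hu) hp0]
  simp only [hinner]
  rw [sum_residues_mul hp0 hu, Finset.sum_eq_single_of_mem 0 (zero_mem_residues hp0),
    Finset.mul_sum]
  · refine Finset.sum_congr rfl fun w _ => ?_
    rw [zero_add, if_pos (dvd_mul_right p w), ← polyChar_mul_right (pow_ne_zero 2 hp0) u]
    congr 2 <;> ring
  · intro y hy hy0
    refine Finset.sum_eq_zero fun w _ => if_neg fun h => hy0 ?_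
    refine eq_of_mem_residues hy (zero_mem_residues hp0) ?_
    rw [sub_zero]
    exact (dvd_add_left (dvd_mul_right p w)).mp h

theorem cubeSum_cube_mul (h3 : (3 : F) ≠ 0) {p u a : F[X]} (hp : Irreducible p) (hu : u ≠ 0)
    (ha : IsCoprime a p) :
    cubeSum (p ^ 3 * u) a = (residues p).card ^ 2 * cubeSum u a := by
  rw [show p ^ 3 * u = p ^ 2 * (u * p) by ring,
    cubeSum_sq_mul h3 hp (mul_ne_zero hu hp.ne_zero) ha, cubeSum_mul_mul hu hp.ne_zero]
  ring

theorem cubeSum_mul_of_isCoprime {r s : F[X]} (hr : r ≠ 0) (hs : s ≠ 0) (hrs : IsCoprime r s)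
    (a : F[X]) :
    cubeSum (r * s) a = cubeSum r (a * s ^ 2) * cubeSum s (a * r ^ 2) := by
  have hrs0 := mul_ne_zero hr hs
  have hper (x y : F[X]) (h : r ∣ x - y) :
      ∑ z ∈ residues s, polyChar (r * s) (a * (x + r * z) ^ 3) =
        ∑ z ∈ residues s, polyChar (r * s) (a * (y + r * z) ^ 3) := by
    obtain ⟨k, hk⟩ := h
    have hx : x = y + r * k := by rw [← hk]; ring
    have hshift := sum_residues_comp hs (f := fun z => polyChar (r * s) (a * (y + r * z) ^ 3))
      (φ := fun z => z + k) (fun z w hzw => polyChar_mul_cube_congr hrs0 a _ _ (by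
        rw [add_sub_add_left_eq_sub, ← mul_sub]
        exact mul_dvd_mul_left r hzw)) (fun z w hzw => by simpa using hzw)
    refine Eq.trans (Finset.sum_congr rfl fun z _ => ?_) hshift
    rw [hx, mul_add, ← add_assoc, add_right_comm]
  have h := sum_residues_comp hr hper (φ := fun y => s * y)
    fun x y => dvd_sub_of_dvd_mul_sub hrs.symm
  unfold cubeSum
  rw [sum_residues_mul hr hs, ← h, Finset.sum_mul_sum]
  refine Finset.sum_congr rfl fun y _ => Finset.sum_congr rfl fun z _ => ?_
  rw [← polyChar_mul_right hs r, ← polyChar_mul_right hr s, mul_comm s r, ← polyChar_add]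
  exact polyChar_congr hrs0
    ⟨a * (3 * s * y ^ 2 * z + 3 * y * r * z ^ 2), by ring⟩

end CubeSum

/-! ### Square-root cancellation for a prime modulus -/

section Prime

variable {F : Type*} [Field F] [Fintype F]

open Classical in
theorem card_cube_roots_le {p : F[X]} (hp : Irreducible p) (c : F[X]) :
    ((residues p).filter fun x => p ∣ x ^ 3 - c).card ≤ 3 := by
  have : Fact (Irreducible p) := ⟨hp⟩
  have h : ((residues p).filter fun x => p ∣ x ^ 3 - c).card ≤
      (nthRoots 3 (AdjoinRoot.mk p c)).toFinset.card := by
    refine Finset.card_le_card_of_injOn (AdjoinRoot.mk p) ?_ ?_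
    · intro x hx
      rw [Finset.mem_coe, Finset.mem_filter] at hx
      rw [Finset.mem_coe, Multiset.mem_toFinset, mem_nthRoots (by norm_num), ← map_pow]
      exact AdjoinRoot.mk_eq_mk.mpr hx.2
    · intro x hx y hy hxy
      rw [Finset.mem_coe, Finset.mem_filter] at hx hy
      exact eq_of_mem_residues hx.1 hy.1 (AdjoinRoot.mk_eq_mk.mp hxy)
  exact h.trans ((Multiset.toFinset_card_le _).trans (card_nthRoots 3 _))

/-- The second moment of `cubeSum p a` over all `a` modulo `p` counts the solutions of
`x³ ≡ y³ mod p`. -/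
theorem sum_norm_cubeSum_sq_le {p : F[X]} (hp : Irreducible p) :
    ∑ c ∈ residues p, ‖cubeSum p c‖ ^ 2 ≤ 3 * ((residues p).card : ℝ) ^ 2 := by
  classical
  have hp0 := hp.ne_zero
  have h : ((∑ c ∈ residues p, ‖cubeSum p c‖ ^ 2 : ℝ) : ℂ) =
      ((∑ y ∈ residues p, (residues p).card *
        ((residues p).filter fun x => p ∣ x ^ 3 - y ^ 3).card : ℕ) : ℂ) := by
    have h1 (c : F[X]) : ((‖cubeSum p c‖ ^ 2 : ℝ) : ℂ) =
        ∑ x ∈ residues p, ∑ y ∈ residues p, polyChar p ((x ^ 3 - y ^ 3) * c) := by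
      rw [Complex.ofReal_pow, ← Complex.mul_conj', cubeSum, map_sum, Finset.sum_mul_sum]
      refine Finset.sum_congr rfl fun x _ => Finset.sum_congr rfl fun y _ => ?_
      rw [starRingEnd_apply, ← polyChar_neg, ← polyChar_add]
      congr 1
      ring
    rw [Complex.ofReal_sum, Finset.sum_congr rfl fun c _ => h1 c, Finset.sum_comm,
      Finset.sum_congr rfl fun x _ => Finset.sum_comm, Finset.sum_comm]
    simp only [sum_polyChar_mul hp0, ← Finset.sum_filter]
    push_cast
    refine Finset.sum_congr rfl fun y _ => ?_
    rw [Finset.sum_const, nsmul_eq_mul, mul_comm]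
  rw [← Complex.ofReal_natCast, Complex.ofReal_inj] at h
  rw [h]
  have h2 : (∑ y ∈ residues p, (residues p).card *
      ((residues p).filter fun x => p ∣ x ^ 3 - y ^ 3).card) ≤ 3 * (residues p).card ^ 2 := by
    calc _ ≤ ∑ y ∈ residues p, (residues p).card * 3 :=
          Finset.sum_le_sum fun y _ => Nat.mul_le_mul_left _ (card_cube_roots_le hp _)
      _ = _ := by rw [Finset.sum_const, smul_eq_mul]; ring
  exact_mod_cast h2

/-- `cubeSum p a` only depends on the class of `a` modulo cubes, and every class modulo `p` is of
the form `a b³` for at most three `b`, so one value is controlled by the second moment. -/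
theorem norm_cubeSum_sq_le {p a : F[X]} (hp : Irreducible p) (ha : IsCoprime a p) :
    ‖cubeSum p a‖ ^ 2 ≤ 18 * polyAbs p := by
  classical
  have hp0 := hp.ne_zero
  set N := (residues p).card with hN
  obtain ⟨a', e, ha'⟩ := ha
  have h1 : ∑ b ∈ (residues p).erase 0, ‖cubeSum p a‖ ^ 2 ≤
      ∑ c ∈ residues p, 3 * ‖cubeSum p c‖ ^ 2 := by
    have hcast : ∀ b ∈ (residues p).erase 0,
        ‖cubeSum p a‖ ^ 2 = ‖cubeSum p (a * b ^ 3 % p)‖ ^ 2 := by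
      intro b hb
      rw [Finset.mem_erase] at hb
      have hcop : IsCoprime b p := by
        refine ((hp.coprime_iff_not_dvd).mpr fun h => hb.1 ?_).symm
        exact eq_of_mem_residues hb.2 (zero_mem_residues hp0) (by simpa using h)
      rw [← cubeSum_mul_cube hp0 hcop a, cubeSum_congr hp0 (dvd_sub_mod p (a * b ^ 3))]
    rw [Finset.sum_congr rfl hcast,
      ← Finset.sum_fiberwise_of_maps_to (t := residues p) (g := fun b => a * b ^ 3 % p)
        fun b _ => mod_mem_residues hp0 _]
    refine Finset.sum_le_sum fun c hc => ?_
    rw [Finset.sum_congr rfl fun b hb => by rw [(Finset.mem_filter.mp hb).2], Finset.sum_const,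
      nsmul_eq_mul]
    refine mul_le_mul_of_nonneg_right ?_ (by positivity)
    have : (((residues p).erase 0).filter fun b => a * b ^ 3 % p = c).card ≤ 3 := by
      refine le_trans (Finset.card_le_card ?_) (card_cube_roots_le hp (a' * c))
      intro b hb
      rw [Finset.mem_filter, Finset.mem_erase] at hb
      rw [Finset.mem_filter]
      refine ⟨hb.1.2, ?_⟩
      obtain ⟨k, hk⟩ := dvd_sub_mod p (a * b ^ 3)
      rw [hb.2] at hk
      exact ⟨a' * k + e * b ^ 3, by linear_combination a' * hk - b ^ 3 * ha'⟩
    exact_mod_cast this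
  rw [← Finset.mul_sum, Finset.sum_const, Finset.card_erase_of_mem (zero_mem_residues hp0),
    nsmul_eq_mul] at h1
  have h2 := sum_norm_cubeSum_sq_le hp
  have hN2 : 2 ≤ N := by
    rw [hN, card_residues hp0]
    calc 2 ≤ Fintype.card F := Fintype.one_lt_card
      _ ≤ _ := Nat.le_self_pow (Irreducible.natDegree_pos hp).ne' _
  rw [← card_residues_eq_polyAbs hp0]
  rw [← hN, Nat.cast_sub (by omega)] at h1
  rw [← hN] at h2 ⊢
  have hN2' : (2 : ℝ) ≤ N := by exact_mod_cast hN2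
  push_cast at h1
  have h4 : (N : ℝ) / 2 * ‖cubeSum p a‖ ^ 2 ≤ N / 2 * (18 * N) := by
    calc (N : ℝ) / 2 * ‖cubeSum p a‖ ^ 2 ≤ (N - 1) * ‖cubeSum p a‖ ^ 2 := by
          gcongr; linarith
      _ ≤ 3 * (3 * (N : ℝ) ^ 2) := h1.trans (by gcongr)
      _ = _ := by ring
  exact le_of_mul_le_mul_left h4 (by positivity)

end Prime

/-! ### The bound for cubic exponential sums -/

section Bound

variable {F : Type*} [Field F] [Fintype F]

theorem mem_monicUpTo {Q : ℤ} {r : F[X]} :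
    r ∈ monicUpTo F Q ↔ r.Monic ∧ (r.natDegree : ℤ) ≤ Q := by
  simp [monicUpTo]

theorem norm_cubeSum_le {r : F[X]} (hr : r ≠ 0) (a : F[X]) : ‖cubeSum r a‖ ≤ polyAbs r := by
  rw [← card_residues_eq_polyAbs hr]
  refine (norm_sum_le _ _).trans_eq ?_
  simp [polyChar, norm_psi]

open Classical in
/-- The number of monic divisors of `n` of degree at most `D`; it is bounded in terms of `D` and
`q`, and grows when a new prime factor of degree at most `D` is introduced. -/
def smallDivisors (D : ℕ) (n : F[X]) : ℕ := ((monicUpTo F D).filter fun p => p ∣ n).card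

theorem smallDivisors_mono {D : ℕ} {n n' : F[X]} (h : n ∣ n') :
    smallDivisors D n ≤ smallDivisors D n' := by
  classical
  refine Finset.card_le_card fun p hp => ?_
  rw [Finset.mem_filter] at hp ⊢
  exact ⟨hp.1, hp.2.trans h⟩

theorem smallDivisors_lt {D : ℕ} {p n : F[X]} (hp : p.Monic) (hD : p.natDegree ≤ D)
    (hpn : ¬ p ∣ n) : smallDivisors D n < smallDivisors D (p * n) := by
  classical
  refine Finset.card_lt_card ((Finset.ssubset_iff_of_subset fun x hx => ?_).mpr ⟨p, ?_, ?_⟩)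
  · rw [Finset.mem_filter] at hx ⊢
    exact ⟨hx.1, hx.2.mul_left p⟩
  · rw [Finset.mem_filter, mem_monicUpTo]
    exact ⟨⟨hp, by exact_mod_cast hD⟩, dvd_mul_right p n⟩
  · rw [Finset.mem_filter]
    exact fun h => hpn h.2

/-- Induction on `r`, splitting off the largest power at most `p³` of a prime factor `p`: cubes of
primes go into `m`, the rest into `n`. The factor `5 > √18` lost at a prime `p` exactly dividing
`r` is absorbed in `|p| ^ δ` unless `p` is one of the finitely many primes of degree at most `D`. -/
theorem norm_cubeSum_le_pow_smallDivisors (h3 : (3 : F) ≠ 0) {δ : ℝ} (hδ : 0 < δ) {D : ℕ}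
    (hD : 5 ≤ ((Fintype.card F : ℝ) ^ D) ^ δ) (N : ℕ) :
    ∀ r : F[X], r.Monic → r.natDegree = N → ∃ m n : F[X], m.Monic ∧ n.Monic ∧ r = m ^ 3 * n ∧
      ∀ a, IsCoprime a r → ‖cubeSum r a‖ ≤
        5 ^ smallDivisors D n * (polyAbs r * (polyAbs m)⁻¹ * polyAbs n ^ (δ - 1 / 2)) := by
  induction N using Nat.strong_induction_on with
  | h N ih =>
    intro r hr hrN
    rcases Nat.eq_zero_or_pos N with hN | hN
    · have hr1 : r = 1 := hr.natDegree_eq_zero.mp (hrN.trans hN)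
      refine ⟨1, 1, monic_one, monic_one, by simp [hr1], fun a _ => ?_⟩
      have h1 : polyAbs (1 : F[X]) = 1 := by simp [polyAbs]
      have h2 := norm_cubeSum_le hr.ne_zero a
      subst hr1
      rw [h1] at h2 ⊢
      rw [Real.one_rpow, inv_one, one_mul, one_mul, mul_one]
      exact h2.trans (one_le_pow₀ (by norm_num))
    have hunit : ¬ IsUnit r := fun h => by
      rw [hr.isUnit_iff.mp h, natDegree_one] at hrN
      omega
    obtain ⟨p, hpm, hp, hpr⟩ := exists_monic_irreducible_factor r hunit
    have hp0 := hp.ne_zero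
    have hpdeg := hp.natDegree_pos
    have hpA := polyAbs_pos hp0
    have hpA1 := one_le_polyAbs hp0
    have hcard := card_residues_eq_polyAbs hp0
    by_cases hp3 : p ^ 3 ∣ r
    · obtain ⟨u, rfl⟩ := hp3
      have hum : u.Monic := (hpm.pow 3).of_mul_monic_left hr
      rw [(hpm.pow 3).natDegree_mul hum, hpm.natDegree_pow] at hrN
      obtain ⟨m, n, hm, hn, hmn, hb⟩ := ih u.natDegree (by omega) u hum rfl
      refine ⟨p * m, n, hpm.mul hm, hn, by rw [hmn]; ring, fun a ha => ?_⟩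
      have hap : IsCoprime a p := ha.of_mul_right_left.of_isCoprime_of_dvd_right
        (dvd_pow_self p three_ne_zero)
      rw [cubeSum_cube_mul h3 hp hum.ne_zero hap, norm_mul, norm_pow, Complex.norm_natCast, hcard,
        polyAbs_mul, polyAbs_mul, polyAbs_pow]
      refine (mul_le_mul_of_nonneg_left (hb a ha.of_mul_right_right) (by positivity)).trans_eq ?_
      field_simp
    by_cases hp2 : p ^ 2 ∣ r
    · obtain ⟨u, rfl⟩ := hp2
      have hum : u.Monic := (hpm.pow 2).of_mul_monic_left hr
      rw [(hpm.pow 2).natDegree_mul hum, hpm.natDegree_pow] at hrN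
      have hpu : ¬ p ∣ u := by
        rintro ⟨v, rfl⟩
        exact hp3 ⟨v, by ring⟩
      obtain ⟨m, n, hm, hn, hmn, hb⟩ := ih u.natDegree (by omega) u hum rfl
      refine ⟨m, p ^ 2 * n, hm, (hpm.pow 2).mul hn, by rw [hmn]; ring, fun a ha => ?_⟩
      have hap : IsCoprime a p := ha.of_mul_right_left.of_isCoprime_of_dvd_right
        (dvd_pow_self p two_ne_zero)
      have hapu : IsCoprime (a * p) u :=
        ha.of_mul_right_right.mul_left ((hp.coprime_iff_not_dvd).mpr hpu)
      have hmA := polyAbs_pos hm.ne_zero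
      have hnA := polyAbs_pos hn.ne_zero
      have huA := polyAbs_pos hum.ne_zero
      rw [cubeSum_sq_mul h3 hp hum.ne_zero hap, norm_mul, Complex.norm_natCast, hcard]
      have hexp : polyAbs p ≤ polyAbs p ^ 2 * (polyAbs p ^ 2) ^ (δ - 1 / 2) := by
        rw [← Real.rpow_natCast, ← Real.rpow_mul hpA.le, ← Real.rpow_add hpA]
        refine Real.self_le_rpow_of_one_le hpA1 ?_
        push_cast
        linarith
      calc polyAbs p * ‖cubeSum u (a * p)‖
          ≤ polyAbs p ^ 2 * (polyAbs p ^ 2) ^ (δ - 1 / 2) * (5 ^ smallDivisors D (p ^ 2 * n) *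
              (polyAbs u * (polyAbs m)⁻¹ * polyAbs n ^ (δ - 1 / 2))) := by
            refine mul_le_mul hexp ((hb _ hapu).trans ?_) (norm_nonneg _) (by positivity)
            gcongr
            · norm_num
            · exact smallDivisors_mono (dvd_mul_left n _)
        _ = _ := by
            rw [polyAbs_mul, polyAbs_mul, polyAbs_pow, Real.mul_rpow (by positivity) hnA.le]
            ring
    · obtain ⟨u, rfl⟩ := hpr
      have hum : u.Monic := hpm.of_mul_monic_left hr
      rw [hpm.natDegree_mul hum] at hrN
      have hpu : ¬ p ∣ u := by
        rintro ⟨v, rfl⟩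
        exact hp2 ⟨v, by ring⟩
      obtain ⟨m, n, hm, hn, hmn, hb⟩ := ih u.natDegree (by omega) u hum rfl
      have hpn : ¬ p ∣ n := fun h => hpu (hmn ▸ h.mul_left _)
      refine ⟨m, p * n, hm, hpm.mul hn, by rw [hmn]; ring, fun a ha => ?_⟩
      have hpuc : IsCoprime p u := (hp.coprime_iff_not_dvd).mpr hpu
      have hmA := polyAbs_pos hm.ne_zero
      have hnA := polyAbs_pos hn.ne_zero
      have huA := polyAbs_pos hum.ne_zero
      rw [cubeSum_mul_of_isCoprime hp0 hum.ne_zero hpuc, norm_mul]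
      have h1 : ‖cubeSum p (a * u ^ 2)‖ ≤ 5 * polyAbs p ^ (1 / 2 : ℝ) := by
        have := norm_cubeSum_sq_le hp
          (ha.of_mul_right_left.mul_left (hpuc.symm.pow_left (m := 2)))
        refine abs_le_of_sq_le_sq' (this.trans ?_) (by positivity) |>.2
        rw [mul_pow, ← Real.sqrt_eq_rpow, Real.sq_sqrt hpA.le]
        nlinarith
      have h2 := hb (a * p ^ 2) (ha.of_mul_right_right.mul_left hpuc.pow_left)
      have h4 : (5 : ℝ) * 5 ^ smallDivisors D n ≤
          polyAbs p ^ δ * 5 ^ smallDivisors D (p * n) := by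
        by_cases hpD : p.natDegree ≤ D
        · rw [← pow_succ']
          calc (5 : ℝ) ^ (smallDivisors D n + 1) ≤ 5 ^ smallDivisors D (p * n) :=
                pow_le_pow_right₀ (by norm_num) (smallDivisors_lt hpm hpD hpn)
            _ ≤ _ := le_mul_of_one_le_left (by positivity) (Real.one_le_rpow hpA1 hδ.le)
        · refine mul_le_mul (hD.trans ?_) (pow_le_pow_right₀ (by norm_num)
            (smallDivisors_mono (dvd_mul_left n p))) (by positivity) (by positivity)
          rw [polyAbs_of_ne_zero hp0]
          have := (one_lt_card_real F).le
          gcongr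
          omega
      calc ‖cubeSum p (a * u ^ 2)‖ * ‖cubeSum u (a * p ^ 2)‖
          ≤ (5 * polyAbs p ^ (1 / 2 : ℝ)) * (5 ^ smallDivisors D n *
              (polyAbs u * (polyAbs m)⁻¹ * polyAbs n ^ (δ - 1 / 2))) :=
            mul_le_mul h1 h2 (norm_nonneg _) (by positivity)
        _ = (5 * 5 ^ smallDivisors D n) * (polyAbs p ^ (1 / 2 : ℝ) *
              (polyAbs u * (polyAbs m)⁻¹ * polyAbs n ^ (δ - 1 / 2))) := by ring
        _ ≤ (polyAbs p ^ δ * 5 ^ smallDivisors D (p * n)) * (polyAbs p ^ (1 / 2 : ℝ) *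
              (polyAbs u * (polyAbs m)⁻¹ * polyAbs n ^ (δ - 1 / 2))) := by gcongr
        _ = _ := by
            have h5 : polyAbs p ^ δ * polyAbs p ^ (1 / 2 : ℝ) =
                polyAbs p * polyAbs p ^ (δ - 1 / 2) := by
              nth_rw 3 [← Real.rpow_one (polyAbs p)]
              rw [← Real.rpow_add hpA, ← Real.rpow_add hpA]
              congr 1
              ring
            rw [polyAbs_mul, polyAbs_mul, Real.mul_rpow hpA.le hnA.le]
            linear_combination (5 ^ smallDivisors D (p * n) * (polyAbs u * (polyAbs m)⁻¹ *
              polyAbs n ^ (δ - 1 / 2))) * h5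

theorem exists_norm_cubeSum_le (h3 : (3 : F) ≠ 0) {δ : ℝ} (hδ : 0 < δ) :
    ∃ K : ℝ, 0 ≤ K ∧ ∀ r : F[X], r.Monic → ∃ m n : F[X], m.Monic ∧ n.Monic ∧ r = m ^ 3 * n ∧
      ∀ a, IsCoprime a r →
        ‖cubeSum r a‖ ≤ K * (polyAbs r * (polyAbs m)⁻¹ * polyAbs n ^ (δ - 1 / 2)) := by
  classical
  obtain ⟨D, hD⟩ := pow_unbounded_of_one_lt 5 (Real.one_lt_rpow (one_lt_card_real F) hδ)
  refine ⟨5 ^ (monicUpTo F D).card, by positivity, fun r hr => ?_⟩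
  have hD' : 5 ≤ ((Fintype.card F : ℝ) ^ D) ^ δ := by
    rw [← Real.rpow_natCast, ← Real.rpow_mul (card_real_pos F).le, mul_comm,
      Real.rpow_mul (card_real_pos F).le, Real.rpow_natCast]
    exact hD.le
  obtain ⟨m, n, hm, hn, hmn, h⟩ := norm_cubeSum_le_pow_smallDivisors h3 hδ hD' _ r hr rfl
  refine ⟨m, n, hm, hn, hmn, fun a ha => (h a ha).trans ?_⟩
  have hmA := polyAbs_pos hm.ne_zero
  have hnA := polyAbs_pos hn.ne_zero
  have hrA := polyAbs_pos hr.ne_zero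
  gcongr
  · norm_num
  · exact Finset.card_filter_le _ _

end Bound

/-! ### The singular series -/

section Series

variable {F : Type*} [Field F] [Fintype F]

/-- The sum is a geometric series, as there are `q ^ k` monic polynomials of degree `k`. -/
theorem summable_polyAbs_rpow (F : Type*) [Field F] [Fintype F] {s : ℝ} (hs : s < -1) :
    Summable fun m : {m : F[X] // m.Monic} => polyAbs m.1 ^ s := by
  have hq := card_real_pos F
  let e (k : ℕ) : {m : {m : F[X] // m.Monic} // m.1.natDegree = k} ≃ (Fin k → F) :=
    (Equiv.subtypeSubtypeEquivSubtypeInter (fun m : F[X] => m.Monic) fun m => m.natDegree = k).trans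
      ((monicEquivDegreeLT k).trans (degreeLTEquiv F k).toEquiv)
  refine (Equiv.sigmaFiberEquiv fun m : {m : F[X] // m.Monic} => m.1.natDegree).summable_iff.mp
    ((summable_sigma_of_nonneg fun x => ?_).mpr ?_)
  · exact Real.rpow_nonneg (polyAbs_pos x.2.1.2.ne_zero).le _
  have hval (k : ℕ) (m : {m : {m : F[X] // m.Monic} // m.1.natDegree = k}) :
      polyAbs m.1.1 ^ s = ((Fintype.card F : ℝ) ^ s) ^ k := by
    rw [polyAbs_of_ne_zero m.1.2.ne_zero, m.2, ← Real.rpow_natCast, ← Real.rpow_natCast,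
      ← Real.rpow_mul hq.le, ← Real.rpow_mul hq.le, mul_comm]
  have hfin (k : ℕ) : Finite {m : {m : F[X] // m.Monic} // m.1.natDegree = k} :=
    Finite.of_equiv _ (e k).symm
  refine ⟨fun k => Summable.of_finite, ?_⟩
  have hgeom : Summable fun k : ℕ => ((Fintype.card F : ℝ) ^ (1 + s)) ^ k :=
    summable_geometric_of_lt_one (by positivity)
      (Real.rpow_lt_one_of_one_lt_of_neg (one_lt_card_real F) (by linarith))
  refine hgeom.congr fun k => ?_
  simp only [Function.comp_apply, Equiv.sigmaFiberEquiv_apply, hval]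
  rw [tsum_const, Nat.card_congr (e k), nsmul_eq_mul, Real.rpow_add hq, Real.rpow_one, mul_pow]
  simp

theorem norm_singularTerm_le {r : F[X]} (hr : r ≠ 0) {B : ℝ}
    (hB : ∀ a, IsCoprime a r → ‖cubeSum r a‖ ≤ polyAbs r * B) :
    ‖singularTerm r‖ ≤ polyAbs r * B ^ 6 := by
  classical
  have hA := polyAbs_pos hr
  have h : ‖expSum r 0‖ ≤ polyAbs r * (polyAbs r * B) ^ 6 := by
    rw [expSum_zero_eq_sum_cubeSum]
    refine (norm_sum_le_of_le (f := fun a => cubeSum r a ^ 6) (n := fun _ => (polyAbs r * B) ^ 6)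
      _ fun a ha => ?_).trans ?_
    · rw [norm_pow]
      gcongr
      exact hB a (Finset.mem_filter.mp ha).2
    · rw [Finset.sum_const, nsmul_eq_mul, ← card_residues_eq_polyAbs hr]
      refine mul_le_mul_of_nonneg_right ?_ (Even.pow_nonneg (by decide) _)
      exact_mod_cast Finset.card_filter_le _ _
  rw [singularTerm, norm_mul, Complex.norm_real, Real.norm_of_nonneg (by positivity)]
  refine (mul_le_mul_of_nonneg_left h (by positivity)).trans_eq ?_
  field_simp

/-- Since `r = m³ n` with `|r| ^ (-6) S_r(0) ≪ |m| ^ (-3) |n| ^ (-2 + 6 δ)`, the series is bounded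
by a product of two convergent sums over `m` and `n` as soon as `σ < 2 / 3`. -/
theorem summable_norm_singularTerm_mul_rpow (h3 : (3 : F) ≠ 0) {σ : ℝ} (hσ : σ < 2 / 3) :
    Summable fun r : {r : F[X] // r.Monic} => ‖singularTerm r.1‖ * polyAbs r.1 ^ σ := by
  -- Any `δ > 0` with `-2 + 6 δ + 2 / 3 < -1` would do.
  obtain ⟨K, -, h⟩ := exists_norm_cubeSum_le h3 (δ := 1 / 36) (by norm_num)
  choose m n hm hn hmn hb using fun r : {r : F[X] // r.Monic} => h r.1 r.2
  let φ : {r : F[X] // r.Monic} → {r : F[X] // r.Monic} × {r : F[X] // r.Monic} :=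
    fun r => (⟨m r, hm r⟩, ⟨n r, hn r⟩)
  have hφ : Function.Injective φ := by
    intro r r' hrr
    simp only [φ, Prod.mk.injEq, Subtype.mk.injEq] at hrr
    exact Subtype.ext (by rw [hmn r, hmn r', hrr.1, hrr.2])
  have hs1 := summable_polyAbs_rpow F (s := -3 + 3 * σ) (by linarith)
  have hs2 := summable_polyAbs_rpow F (s := -2 + 1 / 6 + σ) (by linarith)
  have hprod := (hs1.mul_of_nonneg hs2
    (fun x => Real.rpow_nonneg (polyAbs_pos x.2.ne_zero).le _)
    (fun x => Real.rpow_nonneg (polyAbs_pos x.2.ne_zero).le _)).comp_injective hφ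
  refine Summable.of_nonneg_of_le (fun r => ?_) (fun r => ?_) (hprod.mul_left (K ^ 6))
  · exact mul_nonneg (norm_nonneg _) (Real.rpow_nonneg (polyAbs_pos r.2.ne_zero).le _)
  have hM := polyAbs_pos (hm r).ne_zero
  have hN := polyAbs_pos (hn r).ne_zero
  have hR := polyAbs_pos r.2.ne_zero
  have hle := norm_singularTerm_le r.2.ne_zero
    (B := K * ((polyAbs (m r))⁻¹ * polyAbs (n r) ^ (1 / 36 - 1 / 2 : ℝ)))
    fun a ha => (hb r a ha).trans_eq (by ring)
  refine (mul_le_mul_of_nonneg_right hle (by positivity)).trans_eq ?_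
  have hrabs : polyAbs r.1 = polyAbs (m r) ^ 3 * polyAbs (n r) := by
    rw [← polyAbs_pow, ← polyAbs_mul, ← hmn]
  simp only [Function.comp_apply, φ]
  rw [hrabs, Real.mul_rpow (by positivity) hN.le]
  have e1 : polyAbs (m r) ^ (-3 + 3 * σ) =
      polyAbs (m r) ^ 3 * ((polyAbs (m r))⁻¹) ^ 6 * (polyAbs (m r) ^ 3) ^ σ := by
    have h1 : polyAbs (m r) ^ (-3 : ℝ) = (polyAbs (m r) ^ 3)⁻¹ := by
      rw [Real.rpow_neg hM.le, Real.rpow_ofNat]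
    have h2 : (polyAbs (m r) ^ 3) ^ σ = polyAbs (m r) ^ (3 * σ) := by
      rw [Real.rpow_mul hM.le, Real.rpow_ofNat]
    rw [Real.rpow_add hM, h1, h2]
    field_simp
  have e2 : polyAbs (n r) ^ (-2 + 1 / 6 + σ) =
      polyAbs (n r) * (polyAbs (n r) ^ (1 / 36 - 1 / 2 : ℝ)) ^ 6 * polyAbs (n r) ^ σ := by
    have h1 : polyAbs (n r) ^ (-2 + 1 / 6 : ℝ) =
        polyAbs (n r) * polyAbs (n r) ^ ((1 / 36 - 1 / 2) * (6 : ℕ) : ℝ) := by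
      rw [← Real.rpow_one_add' hN.le (by norm_num)]
      norm_num
    rw [Real.rpow_add hN, ← Real.rpow_mul_natCast hN.le, h1]
  rw [e1, e2]
  ring

theorem summable_singularTerm (h3 : (3 : F) ≠ 0) :
    Summable fun r : {r : F[X] // r.Monic} => singularTerm r.1 := by
  have h := summable_norm_singularTerm_mul_rpow h3 (σ := 0) (by norm_num)
  simp only [Real.rpow_zero, mul_one] at h
  exact h.of_norm

/-- Rankin's trick: in the tail `|r| > q ^ Q` insert the factor `(|r| / q ^ Q) ^ σ ≥ 1`. -/
theorem exists_norm_sum_singularTerm_sub_le (h3 : (3 : F) ≠ 0) {σ : ℝ} (hσ0 : 0 ≤ σ)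
    (hσ : σ < 2 / 3) : ∃ C : ℝ, 0 ≤ C ∧ ∀ Q : ℤ,
      ‖∑ r ∈ monicUpTo F Q, singularTerm r - singularSeries F‖ ≤
        C * ((Fintype.card F : ℝ) ^ Q) ^ (-σ) := by
  classical
  set g : {r : F[X] // r.Monic} → ℝ := fun r => ‖singularTerm r.1‖ * polyAbs r.1 ^ σ with hg
  have hg0 (r) : 0 ≤ g r :=
    mul_nonneg (norm_nonneg _) (Real.rpow_nonneg (polyAbs_pos r.2.ne_zero).le _)
  have hgs : Summable g := summable_norm_singularTerm_mul_rpow h3 hσ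
  have hfs := summable_singularTerm h3
  refine ⟨∑' r, g r, tsum_nonneg hg0, fun Q => ?_⟩
  set U : Finset {r : F[X] // r.Monic} := (monicUpTo F Q).subtype fun r => r.Monic
  have hsum : ∑ r ∈ monicUpTo F Q, singularTerm r = ∑ r ∈ U, singularTerm r.1 :=
    (Finset.sum_subtype_of_mem (fun r => singularTerm r) fun r hr => (mem_monicUpTo.mp hr).1).symm
  have hQ : (0 : ℝ) < (Fintype.card F : ℝ) ^ Q := zpow_pos (card_real_pos F) Q
  rw [hsum, singularSeries, ← hfs.sum_add_tsum_compl (s := U), sub_add_cancel_left, norm_neg]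
  refine (tsum_of_norm_bounded (f := fun r : ↑((U : Set {r : F[X] // r.Monic})ᶜ) =>
    singularTerm r.1.1) ((hgs.subtype _).mul_right
      (((Fintype.card F : ℝ) ^ Q) ^ (-σ))).hasSum fun r => ?_).trans ?_
  · have hr : Q < r.1.1.natDegree := by
      by_contra hlt
      exact r.2 (Finset.mem_subtype.mpr (mem_monicUpTo.mpr ⟨r.1.2, not_lt.mp hlt⟩))
    have hle : (Fintype.card F : ℝ) ^ Q ≤ polyAbs r.1.1 := by
      rw [polyAbs_of_ne_zero r.1.2.ne_zero, ← zpow_natCast]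
      exact zpow_le_zpow_right₀ (one_lt_card_real F).le hr.le
    simp only [Function.comp_apply, hg]
    rw [Real.rpow_neg hQ.le, mul_assoc, ← div_eq_mul_inv]
    refine le_mul_of_one_le_right (norm_nonneg _) ((one_le_div (by positivity)).mpr ?_)
    gcongr
  · rw [tsum_mul_right]
    refine mul_le_mul_of_nonneg_right ?_ (by positivity)
    exact hgs.tsum_subtype_le g _ hg0

end Series

/-! ### The centre term -/

/-- Every `I_r(0)` with `|r| ≤ q ^ Q` equals `|P|⁻³ σ_∞`, so `M(P)` is a multiple of a partial sum
of the singular series. -/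
theorem centreTerm_eq {F : Type*} [Field F] [Fintype F] (h3 : (3 : F) ≠ 0) {A : ℝ} (hA : 0 ≤ A)
    (α : ℕ) (d : ℤ) :
    centreTerm F A α d = singularIntegral F A α *
      (∑ r ∈ monicUpTo F (paramQ A α d), singularTerm r) *
        ((absInf ((tInf : KInf F) ^ d) ^ 3 : ℝ) : ℂ) := by
  have hP : ((absInf ((tInf : KInf F) ^ d) : ℝ) : ℂ) ≠ 0 := by
    rw [absInf_tInf_zpow]
    exact_mod_cast (zpow_pos (card_real_pos F) d).ne'
  rw [centreTerm, circleTerm, Finset.mul_sum, Finset.mul_sum, Finset.sum_mul]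
  refine Finset.sum_congr rfl fun r hr => ?_
  rw [mem_monicUpTo] at hr
  rw [oscIntegral_zero h3 hA α d hr.1 hr.2, singularTerm]
  push_cast
  field_simp

end CubicCircle

end

theorem proposition6p1 (F : Type*) [Field F] [Fintype F] (hchar : 3 < ringChar F) :
    Summable (fun r : {r : F[X] // r.Monic} => CubicCircle.singularTerm r.1) ∧
    ∀ ε : ℝ, 0 < ε → ∃ C : ℝ, ∀ (A : ℝ) (α : ℕ) (d : ℤ), 0 ≤ A → α ∈ ({0, 1, 2} : Set ℕ) →
      (0 ≤ CubicCircle.paramQ A α d ∨ ε ≤ 2 / 3) →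
      ‖CubicCircle.centreTerm F A α d -
          CubicCircle.singularIntegral F A α * CubicCircle.singularSeries F *
            ((CubicCircle.absInf ((CubicCircle.tInf : CubicCircle.KInf F) ^ d) ^ 3 : ℝ) : ℂ)‖
        ≤ C * (‖CubicCircle.singularIntegral F A α‖ *
            CubicCircle.absInf ((CubicCircle.tInf : CubicCircle.KInf F) ^ d) ^ 3 *
            ((Fintype.card F : ℝ) ^ CubicCircle.paramQ A α d) ^ (-2 / 3 + ε)) := by
  have h3 : (3 : F) ≠ 0 := by
    intro h
    have h' : ((3 : ℕ) : F) = 0 := by exact_mod_cast h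
    have := Nat.le_of_dvd (by norm_num) ((ringChar.spec F 3).mp h')
    omega
  refine ⟨CubicCircle.summable_singularTerm h3, fun ε hε => ?_⟩
  -- For `ε > 2 / 3`, where `Q ≥ 0` is assumed, the bound for `ε = 2 / 3` is stronger.
  obtain ⟨C, hC, h⟩ := CubicCircle.exists_norm_sum_singularTerm_sub_le h3
    (σ := 2 / 3 - min ε (2 / 3)) (sub_nonneg.mpr (min_le_right _ _))
    (sub_lt_self _ (lt_min hε (by norm_num)))
  refine ⟨C, fun A α d hA _ hQ => ?_⟩
  set Q := CubicCircle.paramQ A α d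
  have hP := CubicCircle.absInf_nonneg ((CubicCircle.tInf : CubicCircle.KInf F) ^ d)
  have hexp : ((Fintype.card F : ℝ) ^ Q) ^ (-(2 / 3 - min ε (2 / 3))) ≤
      ((Fintype.card F : ℝ) ^ Q) ^ (-2 / 3 + ε) := by
    rcases le_total ε (2 / 3) with hle | hle
    · rw [min_eq_left hle]
      exact le_of_eq (by congr 1; ring)
    · rcases hQ with hQ | hQ
      · refine Real.rpow_le_rpow_of_exponent_le
          (one_le_zpow₀ (CubicCircle.one_lt_card_real F).le hQ) ?_
        rw [min_eq_right hle]
        linarith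
      · rw [min_eq_left hQ]
        exact le_of_eq (by congr 1; ring)
  rw [CubicCircle.centreTerm_eq h3 hA, ← sub_mul, ← mul_sub, norm_mul, norm_mul, Complex.norm_real,
    Real.norm_of_nonneg (pow_nonneg hP 3)]
  calc _ ≤ ‖CubicCircle.singularIntegral F A α‖ *
        (C * ((Fintype.card F : ℝ) ^ Q) ^ (-2 / 3 + ε)) *
          CubicCircle.absInf ((CubicCircle.tInf : CubicCircle.KInf F) ^ d) ^ 3 := by
        gcongr
        exact (h Q).trans (mul_le_mul_of_nonneg_left hexp hC)
    _ = _ := by ring
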